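/- **Setting.** Let $\lambda$ be the security parameter, and let $f=f(\lambda)$, $R=R(\lambda)$ be bounded by polynomials and $D=D(\lambda)\ge 1$, $D=\Theta(\lambda)$. There are $n=3f+1$ validators $p_0,\dots,p_{n-1}$. Everything below takes place in an idealized model with oracles. $\mathrm{Hash}$ (from commitments to seeds in $\{0,1\}^\lambda$) and the two hash functions $H_1,H_2$ of ALBA are independent uniformly random functions. All parties have access to a vector commitment scheme $(\mathrm{Commit},\mathrm{Proof},\mathrm{Verify})$ with finitely many commitments, which may use a further static oracle (public parameters, hash, generic group). The scheme is perfectly correct, each operation makes polynomially many oracle queries, and it is position binding: any attacker with polynomially many queries opens one position of one commitment to two different values only with exponentially small probability. A quantity $\varepsilon(\lambda)$ is *exponentially small* if there is $c>0$ with $\varepsilon(\lambda)\le 2^{-c\lambda}$ for all large $\lambda$. **Reliable broadcast** is ideal. The execution has rounds $1,\dots,R$. For each validator $p_k$ and round $1\le r\le R$, the instance $(r,k)$ is fixed at most once, to a single vertex; if $p_k$ is not corrupted at that time, this is the vertex that $p_k$ broadcast for round $r$. A validator can only deliver the fixed vertex, at most once, at a time chosen by the adversary. When an instance is fixed, it receives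 a *certificate*, an independent uniformly random string in $\{0,1\}^\lambda$, unavailable before. Round $0$ consists of one publicly known certified genesis vertex per validator. **ALBA.** The sampling proofs are those of Telescope ALBA with seed, with $n_p=2f+1$, $n_f=f$, sample size $D$, $2D\lambda$ starting points and final acceptance probability $1/D$. Thus $(i,s_1,\dots,s_D)$ is valid for a seed $\sigma$ if $1\le i\le 2D\lambda$, each $H_1(\sigma,i,s_1,\dots,s_k)$ with $1\le k\le D$ accepts (probability $1/(2f+1)$), and $H_2(\sigma,i,s_1,\dots,s_D)$ accepts (probability $1/D$). The prover outputs some valid proof with elements in its set, if there is one. **Sparse Bullshark.** A round-$r$ vertex has a source, a block, a sample of $D$ references (source and certificate) to round-$(r-1)$ vertices, further such references, and a proof consisting of a commitment $C$, opening proofs of the sampled elements, and an ALBA starting point. Its *edges* are the sampled and the further references. The anchor of an even round $r$ is the vertex of $p_{(r/2)\bmod n}$. * *Creation.* A validator in round $r$ (initially $0$) with a block to propose may advance once its DAG has at least $2f+1$ round-$r$ vertices and one of the following holds: its timer has expired; $r$ is even and the anchor of round $r$ is in its DAG; $r$ is odd and at least $2f+1$ of its round-$r$ vertices reference the anchor of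 round $r-1$, or at least $f+1$ do not. It then commits to the array of the certificates of its round-$r$ vertices ($\bot$ for missing ones), computes an ALBA proof over these with seed $\mathrm{Hash}(C)$ (if there is none, it does not advance), adds references to its own vertex and to the anchor of round $r$, if present, and reliably broadcasts the new vertex of round $r+1$. * *Validation.* A delivered vertex is kept only if its source and round match the broadcast instance, it has at most $D+2$ edges, all openings of sampled elements verify, and the ALBA proof is valid for the seed $\mathrm{Hash}(C)$. It enters the local DAG once all its parents, with matching certificates, are there. * *Ordering.* When a round-$(r+1)$ vertex enters the local DAG, the anchor $v$ of round $r$ is there, at least $2f+1$ vertices of round $r+1$ in the local DAG reference $v$, and $r$ exceeds the last ordered round, the validator commits $v$. It goes down through the rounds $r-2,r-4,\dots$ above the last ordered round, each time also committing the anchor of that round if the current anchor has a path to it, which then becomes the current anchor. It then processes the committed anchors in increasing order of rounds, outputting for each anchor its not yet ordered causal history in a fixed deterministic order. Ordering a vertex with block $m$, round $r$ and source $p_k$ outputs $a\_deliver(m,r,p_k)$. **Adversary.** A randomized adversary with unbounded local computation performs at most $T(\lambda)$ actions, $T$ polynomially bounded. An action is an oracle query, adaptively corrupting a validator (at most $f$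 in total), giving a block to a validator, letting a validator take a step (with its timer expired or not), fixing a broadcast instance, reading the certificate of a fixed instance, or having a fixed vertex delivered to a validator. The adversary sees all vertices broadcast. Thus the network, the processing of delivered vertices and the timers are fully asynchronous, which includes all partially synchronous executions. **Theorem.** For every such adversary, Sparse Bullshark satisfies Total order except with exponentially small probability. That is, except with exponentially small probability the following holds at the end of the execution for all never corrupted validators $p,q$ and all events $e,e'$: if $p$ has output $e$ before $e'$, then $q$ has not output $e'$ before $e$. Here "$x$ is output before $y$" means that $x$ has been output and that $y$ has been output later than $x$ or has not been output at all. -/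

import Mathlib

namespace SparseBullshark

/-! ## Oracle programs, asymptotics -/

/-- A deterministic interactive program which submits requests of type `Q`, receives answers of
type `A`, and finally returns an element of `X`.  Local computation is free; requests are
counted. -/
inductive Prog (Q A X : Type) : Type
  | ret (x : X) : Prog Q A X
  | ask (q : Q) (next : A → Prog Q A X) : Prog Q A X

/-- Run a program against a fixed function answering its requests. -/
def Prog.eval {Q A X : Type} (oracle : Q → A) : Prog Q A X → X
  | .ret x => x
  | .ask q next => (next (oracle q)).eval oracle

/-- The program makes at most `t` requests, whatever the answers are. -/
def Prog.Bounded {Q A X : Type} : Prog Q A X → ℕ → Prop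
  | .ret _, _ => True
  | .ask _ _, 0 => False
  | .ask _ next, t + 1 => ∀ a, (next a).Bounded t

/-- `T` is bounded by a polynomial. -/
def PolyBounded (T : ℕ → ℕ) : Prop :=
  ∃ p : Polynomial ℕ, ∀ k, T k ≤ p.eval k

/-- The error `ε k` is exponentially small in the security parameter `k`. -/
def ExpSmall (ε : ℕ → ENNReal) : Prop :=
  ∃ c : ℝ, 0 < c ∧ ∀ᶠ k : ℕ in Filter.atTop, ε k ≤ ENNReal.ofReal ((2 : ℝ) ^ (-(c * (k : ℝ))))

/-! ## Vector commitments -/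

/-- A vector commitment scheme for vectors of length `n` over `V`, relative to a static idealized
oracle.  `Setup` is the randomness of the trusted setup and of the oracle, and `oracle s` is what
the setup `s` lets everybody query: public parameters, a hash function modelled as a random
function, the operations of a generic group, etc. -/
structure VectorCommitment (n : ℕ) (V : Type) where
  Setup : Type
  Query : Type
  Answer : Type
  Com : Type
  Opening : Type
  finCom : Fintype Com
  law : PMF Setup
  oracle : Setup → Query → Answer
  commit : (Fin n → V) → Prog Query Answer Com
  prove : (Fin n → V) → Fin n → Prog Query Answer Opening
  verify : Com → Fin n → V → Opening → Prog Query Answer Bool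
  correct : ∀ s ∈ law.support, ∀ (a : Fin n → V) (i : Fin n),
    (verify ((commit a).eval (oracle s)) i (a i) ((prove a i).eval (oracle s))).eval (oracle s)
      = true

namespace VectorCommitment

/-- Committing, proving and verifying take polynomially many oracle queries. -/
def Efficient {n : ℕ → ℕ} {V : ℕ → Type} (vc : ∀ k, VectorCommitment (n k) (V k)) : Prop :=
  ∃ T : ℕ → ℕ, PolyBounded T ∧ ∀ k,
    (∀ a, ((vc k).commit a).Bounded (T k)) ∧
    (∀ a i, ((vc k).prove a i).Bounded (T k)) ∧
    (∀ c i x o, ((vc k).verify c i x o).Bounded (T k))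

/-- A claimed double opening: a commitment, a position, and two values with opening proofs. -/
structure DoubleOpening {n : ℕ} {V : Type} (vc : VectorCommitment n V) where
  com : vc.Com
  pos : Fin n
  value₁ : V
  opening₁ : vc.Opening
  value₂ : V
  opening₂ : vc.Opening

/-- A randomized attacker on position binding; it may give up by returning `none`. -/
structure Attacker {n : ℕ} {V : Type} (vc : VectorCommitment n V) where
  Coin : Type
  law : PMF Coin
  prog : Coin → Prog vc.Query vc.Answer (Option (DoubleOpening vc))

/-- The double opening consists of two accepted openings to different values. -/
def DoubleOpening.Succeeds {n : ℕ} {V : Type} {vc : VectorCommitment n V}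
    (b : DoubleOpening vc) (s : vc.Setup) : Prop :=
  b.value₁ ≠ b.value₂ ∧
  (vc.verify b.com b.pos b.value₁ b.opening₁).eval (vc.oracle s) = true ∧
  (vc.verify b.com b.pos b.value₂ b.opening₂).eval (vc.oracle s) = true

/-- The probability that the attacker breaks position binding. -/
noncomputable def Attacker.advantage {n : ℕ} {V : Type} {vc : VectorCommitment n V}
    (B : Attacker vc) : ENNReal :=
  (vc.law.bind fun s => B.law.map fun c => (s, c)).toOuterMeasure
    {w | ∃ b, (B.prog w.2).eval (vc.oracle w.1) = some b ∧ b.Succeeds w.1}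

/-- Position binding: every attacker with polynomially many queries succeeds only with
exponentially small probability. -/
def PositionBinding {n : ℕ → ℕ} {V : ℕ → Type} (vc : ∀ k, VectorCommitment (n k) (V k)) : Prop :=
  ∀ (T : ℕ → ℕ) (B : ∀ k, Attacker (vc k)), PolyBounded T →
    (∀ k c, ((B k).prog c).Bounded (T k)) → ExpSmall fun k => (B k).advantage

end VectorCommitment

/-! ## Parameters and oracles -/

/-- Bit strings of length `k`. -/
abbrev Bits (k : ℕ) : Type := Fin k → Bool

/-- The parameters of one instance of the protocol: security parameter `lam`, resilience `f`
(with `3 * f + 1` validators), sample size `D`, length `R` of the execution in rounds, the type of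
blocks, and a vector commitment scheme.  Vectors have one entry per validator: the certificate of
its vertex, or `none`. -/
structure Setting where
  lam : ℕ
  f : ℕ
  D : ℕ
  R : ℕ
  D_pos : 0 < D
  Block : Type
  vc : VectorCommitment (3 * f + 1) (Option (Bits lam))

/-- The number of validators. -/
abbrev Setting.n (G : Setting) : ℕ := 3 * G.f + 1

/-- Validators. -/
abbrev Setting.Party (G : Setting) : Type := Fin G.n

/-- Certificates that reliable broadcast issues. -/
abbrev Setting.Cert (G : Setting) : Type := Bits G.lam

/-- Seeds for sampling. -/
abbrev Setting.Seed (G : Setting) : Type := Bits G.lam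

/-- The number of starting points of the Telescope ALBA prover (with acceptance probability
`1 / D` at the last step, and sample size `D`). -/
abbrev Setting.starts (G : Setting) : ℕ := 2 * G.D * G.lam

instance (G : Setting) : Fintype G.vc.Com := G.vc.finCom

instance (G : Setting) : Nonempty (Fin G.D) := ⟨⟨0, G.D_pos⟩⟩

/-- A reference to a vertex of the previous round: its source and its certificate. -/
abbrev Ref (G : Setting) : Type := G.Party × G.Cert

/-- Arguments of the first ALBA hash function: a seed (salt), a starting point, and a nonempty
prefix of a sample. -/
abbrev StepInput (G : Setting) : Type :=
  G.Seed × Fin G.starts × (Σ k : Fin G.D, (Fin (k.val + 1) → Ref G))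

/-- Arguments of the second ALBA hash function: a seed, a starting point, and a full sample. -/
abbrev FinalInput (G : Setting) : Type := G.Seed × Fin G.starts × (Fin G.D → Ref G)

/-- The random objects, all independent and uniform: the hash function `Hash` that turns
commitments into seeds, the two hash functions of ALBA, and the certificates. -/
abbrev Tables (G : Setting) : Type :=
  (G.vc.Com → G.Seed) × (StepInput G → Fin (2 * G.f + 1)) × (FinalInput G → Fin G.D) ×
    (G.Party × Fin (G.R + 1) → G.Cert)

/-- Everything random apart from the coins of the adversary. -/
structure World (G : Setting) where
  setup : G.vc.Setup
  tables : Tables G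

namespace World

variable {G : Setting}

/-- `Hash`. -/
def hash (W : World G) (c : G.vc.Com) : G.Seed := W.tables.1 c

/-- First ALBA hash function; the value `0` (probability `1 / (2 f + 1)`) means acceptance. -/
def albaStep (W : World G) (x : StepInput G) : Fin (2 * G.f + 1) := W.tables.2.1 x

/-- Second ALBA hash function; the value `0` (probability `1 / D`) means acceptance. -/
def albaFinal (W : World G) (x : FinalInput G) : Fin G.D := W.tables.2.2.1 x

/-- The certificate of the round-`r` vertex of `k` (rounds above `R` do not occur). -/
def cert (W : World G) (k : G.Party) (r : ℕ) : G.Cert :=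
  if h : r < G.R + 1 then W.tables.2.2.2 (k, ⟨r, h⟩) else fun _ => false

/-- Run a program of the vector commitment scheme. -/
def runVC (W : World G) {X : Type} (p : Prog G.vc.Query G.vc.Answer X) : X :=
  p.eval (G.vc.oracle W.setup)

end World

open Classical in
noncomputable instance (G : Setting) : Fintype (StepInput G) :=
  inferInstanceAs (Fintype (_ × _ × _))

open Classical in
noncomputable instance (G : Setting) : Fintype (FinalInput G) :=
  inferInstanceAs (Fintype (_ × _ × _))

open Classical in
noncomputable instance (G : Setting) : Fintype (Tables G) := by
  unfold Tables
  infer_instance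

open Classical in
/-- The law of the random objects. -/
noncomputable def worldLaw (G : Setting) : PMF (World G) :=
  G.vc.law.bind fun s => (PMF.uniformOfFintype (Tables G)).map fun t => ⟨s, t⟩

/-! ## Telescope ALBA with a seed, with `n_p = 2 f + 1` and `n_f = f` -/

/-- An ALBA proof: a starting point and a sample of size `D`. -/
abbrev AlbaProof (G : Setting) : Type := Fin G.starts × (Fin G.D → Ref G)

/-- `ALBA.Verify`: all nonempty prefixes are accepted by the first hash function, and the whole
sample is accepted by the second. -/
def AlbaVerify {G : Setting} (W : World G) (seed : G.Seed) (p : AlbaProof G) : Prop :=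
  (∀ k : Fin G.D,
    (W.albaStep (seed, p.1, ⟨k, fun j => p.2 ⟨j.val, lt_of_lt_of_le j.isLt k.isLt⟩⟩)).val = 0) ∧
  (W.albaFinal (seed, p.1, p.2)).val = 0

open Classical in
/-- `ALBA.Prove`: a valid proof with all sampled elements in `S`, if there is one. -/
noncomputable def albaProve {G : Setting} (W : World G) (seed : G.Seed) (S : Set (Ref G)) :
    Option (AlbaProof G) :=
  if h : ∃ p : AlbaProof G, (∀ t, p.2 t ∈ S) ∧ AlbaVerify W seed p then some h.choose else none

/-! ## Vertices and local states -/

/-- A vertex.  `extra` are the references beyond the sample (own previous vertex and anchor);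
`com`, `openings` and `start` make up the proof of sampling. -/
structure Vertex (G : Setting) where
  round : ℕ
  source : G.Party
  block : G.Block
  sample : Fin G.D → Ref G
  extra : Finset (Ref G)
  com : G.vc.Com
  openings : Fin G.D → G.vc.Opening
  start : Fin G.starts

/-- All outgoing edges, to vertices of the previous round. -/
def Vertex.edges {G : Setting} (v : Vertex G) : Finset (Ref G) :=
  Finset.univ.image v.sample ∪ v.extra

/-- Positions in the DAG: round and source. -/
abbrev Pos (G : Setting) : Type := ℕ × G.Party

/-- Local views of the DAG.  Round `0` consists of one implicit genesis vertex per validator, which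
is known to everybody and is not stored. -/
abbrev Dag (G : Setting) : Type := Pos G → Option (Vertex G)

/-- The local state of a validator.  `ordered` is the sequence of ordered vertices. -/
structure PartyState (G : Setting) where
  currentRound : ℕ
  dag : Dag G
  buffer : Dag G
  delivered : Set (Pos G)
  blocksToPropose : List G.Block
  lastOrderedRound : ℕ
  ordered : List (Vertex G)

/-- Initial local state. -/
def PartyState.init (G : Setting) : PartyState G where
  currentRound := 0
  dag := fun _ => none
  buffer := fun _ => none
  delivered := ∅
  blocksToPropose := []
  lastOrderedRound := 0
  ordered := []

/-- A deterministic rule for listing the vertices of a finite set. -/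
structure HistoryOrder (G : Setting) where
  list : Finset (Vertex G) → List (Vertex G)
  nodup : ∀ s, (list s).Nodup
  mem_iff : ∀ s v, v ∈ list s ↔ v ∈ s

section Local

variable {G : Setting} (W : World G)

/-- The entry of validator `k` in the array `DAG[r]`, as a certificate or `none`. -/
def certAt (dag : Dag G) (r : ℕ) (k : G.Party) : Option G.Cert :=
  if r = 0 then some (W.cert k 0) else (dag (r, k)).map fun _ => W.cert k r

/-- The round-robin leader of an even round. -/
def leader (G : Setting) (r : ℕ) : G.Party := ⟨(r / 2) % G.n, Nat.mod_lt _ (Nat.succ_pos _)⟩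

/-- `GetAnchor(r)` as a vertex (never a genesis vertex). -/
def getAnchor (dag : Dag G) (r : ℕ) : Option (Vertex G) :=
  if r % 2 = 1 then none else dag (r, leader G r)

/-- `GetAnchor(r)` as a reference; for `r = 0` it is the genesis vertex of the leader. -/
def anchorRef (dag : Dag G) (r : ℕ) : Option (Ref G) :=
  if r % 2 = 1 then none else (certAt W dag r (leader G r)).map fun c => (leader G r, c)

/-- The vertex `w` lies in the local DAG and `v` has an edge to it. -/
def HasEdge (dag : Dag G) (v w : Vertex G) : Prop :=
  dag (w.round, w.source) = some w ∧ w.round + 1 = v.round ∧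
    (w.source, W.cert w.source w.round) ∈ v.edges

/-- `PathExists(v, u)`. -/
def PathExists (dag : Dag G) (v u : Vertex G) : Prop :=
  Relation.ReflTransGen (HasEdge W dag) v u

open Classical in
/-- The number of vertices of `DAG[r]` with an edge to the anchor of round `r - 1`. -/
noncomputable def votesFor (dag : Dag G) (r : ℕ) : ℕ :=
  (Finset.univ.filter fun k : G.Party =>
    ∃ v a, dag (r, k) = some v ∧ anchorRef W dag (r - 1) = some a ∧ a ∈ v.edges).card

open Classical in
/-- The number of vertices of `DAG[r]` without an edge to the anchor of round `r - 1`. -/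
noncomputable def votesAgainst (dag : Dag G) (r : ℕ) : ℕ :=
  (Finset.univ.filter fun k : G.Party =>
    ∃ v, dag (r, k) = some v ∧ ∀ a, anchorRef W dag (r - 1) = some a → a ∉ v.edges).card

open Classical in
/-- `MayAdvanceRound`. -/
def MayAdvanceRound (s : PartyState G) (timerExpired : Bool) : Prop :=
  2 * G.f + 1 ≤ (Finset.univ.filter fun k : G.Party =>
      (certAt W s.dag s.currentRound k).isSome).card ∧
  (timerExpired = true ∨
    if s.currentRound % 2 = 0 then (anchorRef W s.dag s.currentRound).isSome = true
    else 2 * G.f + 1 ≤ votesFor W s.dag s.currentRound ∨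
      G.f + 1 ≤ votesAgainst W s.dag s.currentRound)

open Classical in
/-- `CreateNewVertex(round)` by validator `i` for the given block, including `VerifiablySample`.
The result is `none` if sampling fails. -/
noncomputable def createNewVertex (i : G.Party) (dag : Dag G) (round : ℕ) (b : G.Block) :
    Option (Vertex G) :=
  let vec : G.Party → Option G.Cert := certAt W dag (round - 1)
  let com : G.vc.Com := W.runVC (G.vc.commit vec)
  let S : Set (Ref G) := {x | vec x.1 = some x.2}
  (albaProve W (W.hash com) S).map fun p =>
    { round := round
      source := i
      block := b
      sample := p.2
      extra := ((vec i).map fun c => (i, c)).toFinset ∪ (anchorRef W dag (round - 1)).toFinset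
      com := com
      openings := fun t => W.runVC (G.vc.prove vec (p.2 t).1)
      start := p.1 }

/-- `ValidateSample`. -/
def ValidateSample (v : Vertex G) : Prop :=
  (∀ t, W.runVC (G.vc.verify v.com (v.sample t).1 (some (v.sample t).2) (v.openings t)) = true) ∧
  AlbaVerify W (W.hash v.com) (v.start, v.sample)

/-- `ValidateVertex(v, round, k)`. -/
def ValidateVertex (v : Vertex G) (round : ℕ) (k : G.Party) : Prop :=
  v.source = k ∧ v.round = round ∧ v.edges.card ≤ G.D + 2 ∧ ValidateSample W v

open Classical in
/-- The vertices in the local DAG. -/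
noncomputable def dagVertices (dag : Dag G) : Finset (Vertex G) :=
  (Finset.Icc 1 G.R ×ˢ Finset.univ).biUnion fun p => (dag p).toFinset

open Classical in
/-- The loop of `OrderAnchors`: walk down from round `r` in steps of two while `r` is above `last`,
with current anchor `anchor`, pushing onto the stack (whose top is the head of the list). -/
noncomputable def anchorStack (dag : Dag G) (last : ℕ) :
    ℕ → Vertex G → List (Vertex G) → List (Vertex G)
  | 0, _, stack => stack
  | 1, _, stack => stack
  | r + 2, anchor, stack =>
    if r + 2 ≤ last then stack
    else match getAnchor dag (r + 2) with
      | none => anchorStack dag last r anchor stack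
      | some prev =>
        if PathExists W dag anchor prev then anchorStack dag last r prev (prev :: stack)
        else anchorStack dag last r anchor stack

open Classical in
/-- `OrderHistory`: pop the anchors one by one and append their causal history, as far as it has
not been ordered yet. -/
noncomputable def orderHistory (ord : HistoryOrder G) (dag : Dag G) :
    List (Vertex G) → List (Vertex G) → List (Vertex G)
  | [], ordered => ordered
  | anchor :: stack, ordered =>
    orderHistory ord dag stack (ordered ++ ord.list
      ((dagVertices dag).filter fun v => PathExists W dag anchor v ∧ v ∉ ordered))

open Classical in
/-- `OrderAnchors(v)`. -/
noncomputable def orderAnchors (ord : HistoryOrder G) (s : PartyState G) (v : Vertex G) :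
    PartyState G :=
  if v.round ≤ s.lastOrderedRound then s
  else { s with
    lastOrderedRound := v.round
    ordered := orderHistory W ord s.dag
      (anchorStack W s.dag s.lastOrderedRound (v.round - 2) v [v]) s.ordered }

open Classical in
/-- `TryCommitting(v)`, with direct commit threshold `2 f + 1`. -/
noncomputable def tryCommitting (ord : HistoryOrder G) (s : PartyState G) (v : Vertex G) :
    PartyState G :=
  match getAnchor s.dag (v.round - 1) with
  | none => s
  | some anchor =>
    if 2 * G.f + 1 ≤ votesFor W s.dag v.round then orderAnchors W ord s anchor else s

open Classical in
/-- The upcall `r_deliver(v, round, k)`, at most once for each `(round, k)`. -/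
noncomputable def onDeliver (s : PartyState G) (v : Vertex G) (round : ℕ) (k : G.Party) :
    PartyState G :=
  if (round, k) ∈ s.delivered then s
  else { s with
    delivered := insert (round, k) s.delivered
    buffer := if ValidateVertex W v round k then Function.update s.buffer (round, k) (some v)
      else s.buffer }

open Classical in
/-- Move a vertex from the buffer to the DAG if all its parents are in the DAG, and try to
commit. -/
noncomputable def insertVertex (ord : HistoryOrder G) (s : PartyState G) (p : Pos G) :
    PartyState G :=
  match s.buffer p with
  | none => s
  | some v =>
    if ∀ x ∈ v.edges, certAt W s.dag (v.round - 1) x.1 = some x.2 then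
      tryCommitting W ord { s with
        dag := Function.update s.dag p (some v)
        buffer := Function.update s.buffer p none } v
    else s

open Classical in
/-- Try to advance to the next round and create a vertex; the second component is the vertex that
is handed to reliable broadcast. -/
noncomputable def tryAdvance (i : G.Party) (s : PartyState G) (timerExpired : Bool) :
    PartyState G × Option (Vertex G) :=
  match s.blocksToPropose with
  | [] => (s, none)
  | b :: rest =>
    if s.currentRound + 1 ≤ G.R ∧ MayAdvanceRound W s timerExpired then
      match createNewVertex W i s.dag (s.currentRound + 1) b with
      | none => (s, none)
      | some v => ({ s with
          currentRound := s.currentRound + 1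
          blocksToPropose := rest }, some v)
    else (s, none)

end Local

/-! ## Executions -/

/-- The global state: local states, the set of corrupted validators, the vertices handed to
reliable broadcast by validators following the protocol, and the vertices that the broadcast
instances `(round, source)` have been fixed to. -/
structure State (G : Setting) where
  party : G.Party → PartyState G
  corrupted : Finset G.Party
  sent : Dag G
  fixed : Dag G

/-- Initial global state. -/
def State.init (G : Setting) : State G where
  party := fun _ => PartyState.init G
  corrupted := ∅
  sent := fun _ => none
  fixed := fun _ => none

/-- The actions of the adversary, who also schedules the network, the validators and their timers,
and chooses the inputs of the validators. -/
inductive Op (G : Setting) : Type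
  /-- Query `Hash`. -/
  | hash (c : G.vc.Com)
  /-- Query the first hash function of ALBA. -/
  | albaStep (x : StepInput G)
  /-- Query the second hash function of ALBA. -/
  | albaFinal (x : FinalInput G)
  /-- Query the oracle of the vector commitment scheme. -/
  | vcQuery (q : G.vc.Query)
  /-- Read the certificate of a vertex, which exists once the vertex is fixed. -/
  | readCert (k : G.Party) (r : ℕ)
  /-- Corrupt a validator. -/
  | corrupt (k : G.Party)
  /-- Validator `i` is asked to broadcast the block `b`. -/
  | abcast (i : G.Party) (b : G.Block)
  /-- Let validator `i` try to advance to its next round. -/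
  | advance (i : G.Party) (timerExpired : Bool)
  /-- Reliable broadcast fixes the message of instance `(r, k)`. -/
  | fix (k : G.Party) (r : ℕ) (v : Vertex G)
  /-- Reliable broadcast delivers the message of instance `(r, k)` to validator `i`. -/
  | deliver (i k : G.Party) (r : ℕ)
  /-- Validator `i` examines the vertex at position `(r, k)` of its buffer. -/
  | insert (i k : G.Party) (r : ℕ)

/-- What the adversary learns from an action. -/
inductive Resp (G : Setting) : Type
  | seed (x : G.Seed)
  | step (x : Fin (2 * G.f + 1))
  | final (x : Fin G.D)
  | vc (x : G.vc.Answer)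
  | cert (x : Option G.Cert)
  | sent (v : Option (Vertex G))
  | done

section Execution

variable {G : Setting}

open Classical in
/-- One step of an execution.  Reliable broadcast is ideal: each instance `(r, k)` with
`1 ≤ r ≤ R` is fixed at most once, for a validator that is not corrupted only to the vertex which
it has broadcast, and only the fixed vertex is ever delivered. -/
noncomputable def State.step (W : World G) (ord : HistoryOrder G) (σ : State G) : Op G → State G × Resp G
  | .hash c => (σ, .seed (W.hash c))
  | .albaStep x => (σ, .step (W.albaStep x))
  | .albaFinal x => (σ, .final (W.albaFinal x))
  | .vcQuery q => (σ, .vc (G.vc.oracle W.setup q))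
  | .readCert k r => (σ, .cert (certAt W σ.fixed r k))
  | .corrupt k =>
    (if (insert k σ.corrupted).card ≤ G.f then { σ with corrupted := insert k σ.corrupted }
      else σ, .done)
  | .abcast i b =>
    let s := σ.party i
    let s' : PartyState G := { s with blocksToPropose := s.blocksToPropose ++ [b] }
    ({ σ with party := Function.update σ.party i s' }, .done)
  | .advance i timerExpired =>
    match tryAdvance W i (σ.party i) timerExpired with
    | (_, none) => (σ, .sent none)
    | (s, some v) => ({ σ with
        party := Function.update σ.party i s
        sent := Function.update σ.sent (v.round, i) (some v) }, .sent (some v))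
  | .fix k r v =>
    (if σ.fixed (r, k) = none ∧ 1 ≤ r ∧ r ≤ G.R ∧ (k ∈ σ.corrupted ∨ σ.sent (r, k) = some v) then
      { σ with fixed := Function.update σ.fixed (r, k) (some v) } else σ, .done)
  | .deliver i k r =>
    (match σ.fixed (r, k) with
      | none => σ
      | some v => { σ with
          party := Function.update σ.party i (onDeliver W (σ.party i) v r k) }, .done)
  | .insert i k r =>
    ({ σ with party := Function.update σ.party i (insertVertex W ord (σ.party i) (r, k)) }, .done)

/-- The final state of the execution in which the adversary follows a given program. -/
noncomputable def State.run (W : World G) (ord : HistoryOrder G) :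
    State G → Prog (Op G) (Resp G) Unit → State G
  | σ, .ret _ => σ
  | σ, .ask q next => State.run W ord (State.step W ord σ q).1 (next (State.step W ord σ q).2)

end Execution

/-- Events `a_deliver(m, r, p)`. -/
abbrev Event (G : Setting) : Type := G.Block × ℕ × G.Party

/-- The sequence of events `a_deliver` that validator `i` has output. -/
def State.outputs {G : Setting} (σ : State G) (i : G.Party) : List (Event G) :=
  (σ.party i).ordered.map fun v => (v.block, v.round, v.source)

/-- `e` is output before `e'`: `e` is output, and `e'` is output later or not at all. -/
def OutputsBefore {E : Type} (log : List E) (e e' : E) : Prop :=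
  ∃ l₁ l₂, log = l₁ ++ e :: l₂ ∧ (e' ∈ l₂ ∨ e' ∉ log)

/-- The Total order property of Byzantine atomic broadcast. -/
def TotalOrder {G : Setting} (σ : State G) : Prop :=
  ∀ i j : G.Party, i ∉ σ.corrupted → j ∉ σ.corrupted → ∀ e e' : Event G,
    OutputsBefore (σ.outputs i) e e' → ¬ OutputsBefore (σ.outputs j) e' e

/-- A randomized adversary. -/
structure Adversary (G : Setting) where
  Coin : Type
  law : PMF Coin
  prog : Coin → Prog (Op G) (Resp G) Unit

/-- The probability that Total order is violated in the execution with the adversary `A`. -/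
noncomputable def violationProb {G : Setting} (ord : HistoryOrder G) (A : Adversary G) : ENNReal :=
  ((worldLaw G).bind fun W => A.law.map fun c => (W, c)).toOuterMeasure
    {w | ¬ TotalOrder (State.run w.1 ord (State.init G) (A.prog w.2))}

end SparseBullshark

namespace SparseBullshark

/-! ## Local views of a global DAG -/

section Ordering

variable {G : Setting} (W : World G)

/-! The ordering rule is deterministic, so safety reduces to one combinatorial property of the DAG
`F` of all well-placed vertices that are fixed by the end of the execution. This is `QuorumsMeet`: a
valid vertex of round `r + 1` has an edge into any quorum of `2f + 1` votes of round `r`. With `2f +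
1` edges per vertex it would be quorum intersection; with `D` sampled edges it is only very likely.

Granted this property, every vertex at least two rounds above an anchor with a quorum has a path to
it (`Decided.path`), so the walk down from any later anchor passes through it
(`Decided.anchorStack_split`). Local DAGs are causally closed parts of `F`, hence walks and
histories computed locally agree with those computed in `F`. The output of a validator is thus a
function of its last directly committed anchor. Any two outputs are prefix-comparable and free of
repetitions, which gives Total order (`totalOrder_of_outputInv`).

If the property fails at a vertex `w`, consider the first step `t` in which `Hash` is evaluated at
the commitment of `w` (`not_quorumsMeet`). Either the resulting seed was used with ALBA before; or
some sampled parent of `w` was not fixed at step `t`, so that the commitment opens to a certificate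
that did not exist yet; or the seed is fresh and there is a valid sample inside a set of at most `f`
non-voters that was settled before the seed was used.

Each case is bounded by resampling the part of the random tables that the execution has not read
(`avg_mix`). A reused seed in step `t` has probability at most `t / 2 ^ lam`. An escaping sample is
excluded by a union bound over `2 D lam * f ^ D` candidates, each valid with probability `(2f + 1) ^
(-D) / D`, in total at most `2 lam / 2 ^ D`. A premature opening is treated by forking
(`avg_le_fork`): two executions that differ only in the missing certificate coincide up to step `t`,
share the commitment, and open it to two different values unless the certificates collide. An
attacker simulating both executions would break position binding. Forking costs a square root, which
preserves exponential smallness, and only polynomially many cases are summed. -/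

theorem certAt_eq_some_iff {d : Dag G} {r : ℕ} {k : G.Party} {c : G.Cert} (hr : 1 ≤ r) :
    certAt W d r k = some c ↔ (∃ u, d (r, k) = some u) ∧ c = W.cert k r := by
  have h : r ≠ 0 := by omega
  cases hd : d (r, k) <;> simp [certAt, h, hd, eq_comm]

theorem certAt_mono {d d' : Dag G} (h : ∀ p v, d p = some v → ∃ v', d' p = some v') {r : ℕ}
    {k : G.Party} {c : G.Cert} (hc : certAt W d r k = some c) : certAt W d' r k = some c := by
  by_cases hr : r = 0
  · simpa [certAt, hr] using hc
  · rw [certAt_eq_some_iff W (by omega)] at hc ⊢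
    obtain ⟨⟨u, hu⟩, hc⟩ := hc
    exact ⟨h _ _ hu, hc⟩

/-- The reference to the anchor of round `r`. -/
def anchorOf (r : ℕ) : Ref G := (leader G r, W.cert (leader G r) r)

open Classical in
/-- The validators whose vertex of round `r` references the anchor of round `r - 1`. -/
noncomputable def voters (F : Dag G) (r : ℕ) : Finset G.Party :=
  Finset.univ.filter fun k => ∃ u, F (r, k) = some u ∧ anchorOf W (r - 1) ∈ u.edges

/-- Every vertex is stored at its own position, and rounds range over `1, …, R`. -/
def WellPlaced (F : Dag G) : Prop :=
  ∀ p v, F p = some v → (v.round, v.source) = p ∧ 1 ≤ p.1 ∧ p.1 ≤ G.R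

/-- A causally closed part of the DAG `F` consisting of vertices with valid samples and with
commitments in `M`. -/
structure IsView (F : Dag G) (M : Set G.vc.Com) (d : Dag G) : Prop where
  sub : ∀ p v, d p = some v → F p = some v
  valid : ∀ p v, d p = some v → ValidateSample W v ∧ v.com ∈ M
  closed : ∀ p v, d p = some v → ∀ x ∈ v.edges, certAt W d (v.round - 1) x.1 = some x.2

/-- Every valid vertex has an edge to one of the voters for an anchor with a quorum. -/
def QuorumsMeet (F : Dag G) (M : Set G.vc.Com) : Prop :=
  ∀ (w : Vertex G) (r : ℕ), 1 ≤ r → F (r + 1, w.source) = some w → w.round = r + 1 →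
    ValidateSample W w → w.com ∈ M →
    (∀ x ∈ w.edges, certAt W F r x.1 = some x.2) →
    2 * G.f + 1 ≤ (voters W F r).card → ∃ x ∈ w.edges, x.1 ∈ voters W F r

/-- `v` is an anchor which has a quorum of votes and lies in some view. -/
structure Decided (F : Dag G) (M : Set G.vc.Com) (v : Vertex G) : Prop where
  even : v.round % 2 = 0
  source : v.source = leader G v.round
  quorum : 2 * G.f + 1 ≤ (voters W F (v.round + 1)).card
  inView : ∃ d, IsView W F M d ∧ d (v.round, v.source) = some v

variable {W} {F : Dag G} {M : Set G.vc.Com} {d : Dag G}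

theorem IsView.pos (hF : WellPlaced F) (hd : IsView W F M d) {p : Pos G} {v : Vertex G}
    (h : d p = some v) : (v.round, v.source) = p := (hF p v (hd.sub p v h)).1

theorem IsView.self (hF : WellPlaced F) (hd : IsView W F M d) {p : Pos G} {v : Vertex G}
    (h : d p = some v) : d (v.round, v.source) = some v := by
  rw [hd.pos hF h, h]

theorem hasEdge_mono {d' : Dag G} (h : ∀ p v, d p = some v → d' p = some v) {v w : Vertex G}
    (hvw : HasEdge W d v w) : HasEdge W d' v w := ⟨h _ _ hvw.1, hvw.2⟩

theorem IsView.exists_parent (hF : WellPlaced F) (hd : IsView W F M d) {p : Pos G} {v : Vertex G}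
    (h : d p = some v) (hr : 2 ≤ v.round) {x : Ref G} (hx : x ∈ v.edges) :
    ∃ u, d (v.round - 1, x.1) = some u ∧ u.round = v.round - 1 ∧ u.source = x.1 ∧
      HasEdge W F v u := by
  obtain ⟨⟨u, hu⟩, hc⟩ := (certAt_eq_some_iff W (by omega)).1 (hd.closed p v h x hx)
  have hp := hd.pos hF hu
  simp only [Prod.mk.injEq] at hp
  refine ⟨u, hu, hp.1, hp.2, ?_, by omega, ?_⟩
  · rw [hd.pos hF hu]; exact hd.sub _ _ hu
  · rw [hp.1, hp.2, ← hc]; exact hx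

/-- Causal closure, applied edge by edge: closedness supplies some vertex of the view at the
target's position, and as the view is part of `F` this vertex is the target itself. -/
theorem IsView.path_of_path (hF : WellPlaced F) (hd : IsView W F M d) {v u : Vertex G}
    (hv : d (v.round, v.source) = some v) (h : PathExists W F v u) :
    PathExists W d v u ∧ d (u.round, u.source) = some u := by
  induction h with
  | refl => exact ⟨.refl, hv⟩
  | @tail b c _ hbc ih =>
    obtain ⟨hp, hb⟩ := ih
    have hc1 := hF _ _ hbc.1
    have h1 := hd.closed _ _ hb _ hbc.2.2
    rw [show b.round - 1 = c.round by have := hbc.2.1; omega,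
      certAt_eq_some_iff W hc1.2.1] at h1
    obtain ⟨⟨c', hc'⟩, -⟩ := h1
    have : some c' = some c := (hd.sub _ _ hc').symm.trans hbc.1
    rw [Option.some.inj this] at hc'
    exact ⟨hp.tail ⟨hc', hbc.2⟩, hc'⟩

theorem IsView.path_iff (hF : WellPlaced F) (hd : IsView W F M d) {v u : Vertex G}
    (hv : d (v.round, v.source) = some v) : PathExists W d v u ↔ PathExists W F v u :=
  ⟨fun h => Relation.ReflTransGen.mono (fun _ _ => hasEdge_mono hd.sub) _ _ h,
    fun h => (hd.path_of_path hF hv h).1⟩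

theorem mem_voters {r : ℕ} {k : G.Party} :
    k ∈ voters W F r ↔ ∃ u, F (r, k) = some u ∧ anchorOf W (r - 1) ∈ u.edges := by
  classical simp [voters]

/-- Every vertex at least two rounds above a decided anchor has a path to it. -/
theorem Decided.path (hF : WellPlaced F) (hM : QuorumsMeet W F M) {v : Vertex G}
    (hv : Decided W F M v) (hd : IsView W F M d) {w : Vertex G}
    (hw : d (w.round, w.source) = some w) (hr : v.round + 2 ≤ w.round) :
    PathExists W F w v := by
  obtain ⟨dv, hdv, hvd⟩ := hv.inView
  have hvF := hdv.sub _ _ hvd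
  have hv1 := (hF _ _ hvF).2.1
  induction hn : w.round - (v.round + 2) generalizing w with
  | zero =>
    -- Two rounds above `v`, `QuorumsMeet` yields an edge from `w` to a voter, and a voter has an
    -- edge to `v`.
    have hwr : w.round = v.round + 1 + 1 := by omega
    obtain ⟨x, hx, hxv⟩ := hM w (v.round + 1) (by omega) (by rw [← hwr]; exact hd.sub _ _ hw) hwr
      (hd.valid _ _ hw).1 (hd.valid _ _ hw).2
      (fun x hx => by
        have := hd.closed _ _ hw x hx
        rw [hwr, Nat.add_sub_cancel] at this
        exact certAt_mono W (fun p v h => ⟨v, hd.sub p v h⟩) this) hv.quorum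
    obtain ⟨u, hu, hur, hus, he⟩ := hd.exists_parent hF hw (by omega) hx
    obtain ⟨u', hu', ha⟩ := mem_voters.1 hxv
    have hur' : u.round = v.round + 1 := by omega
    rw [show w.round - 1 = v.round + 1 by omega] at hu
    obtain rfl := Option.some.inj ((hd.sub _ _ hu).symm.trans hu')
    refine Relation.ReflTransGen.head he (.single ⟨hvF, hur'.symm, ?_⟩)
    rw [hv.source]
    exact ha
  | succ n ih =>
    -- Higher up any parent will do; one exists because `D` is positive.
    have hx : w.sample ⟨0, G.D_pos⟩ ∈ w.edges :=
      Finset.mem_union_left _ (Finset.mem_image_of_mem _ (Finset.mem_univ _))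
    obtain ⟨u, hu, hur, hus, he⟩ := hd.exists_parent hF hw (by omega) hx
    exact Relation.ReflTransGen.head he (ih (hd.self hF hu) (by omega) (by omega))

/-! ### The walk down the anchors. -/

theorem getAnchor_eq_some {r : ℕ} {v : Vertex G} :
    getAnchor d r = some v ↔ r % 2 ≠ 1 ∧ d (r, leader G r) = some v := by
  unfold getAnchor
  split_ifs with h <;> simp [h]

/-- The walk only pushes onto the stack and never inspects it. -/
theorem anchorStack_append (d : Dag G) (last r : ℕ) (a : Vertex G) (l : List (Vertex G)) :
    anchorStack W d last r a l = anchorStack W d last r a [] ++ l := by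
  induction r using Nat.twoStepInduction generalizing a l with
  | zero => simp [anchorStack]
  | one => simp [anchorStack]
  | more r ih _ =>
    simp only [anchorStack]
    split_ifs with h
    · simp
    · cases getAnchor d (r + 2) with
      | none => exact ih _ _
      | some p =>
        dsimp only
        split_ifs
        · rw [ih p (p :: l), ih p [p]]; simp
        · exact ih _ _

/-- A view may lack an anchor that `F` contains. By causal closure `F` then has no path to it from
an anchor of the view, so the walk in `F` skips it as well. -/
theorem IsView.anchorStack_eq (hF : WellPlaced F) (hd : IsView W F M d) (last r : ℕ)
    {a : Vertex G} (ha : d (a.round, a.source) = some a) (l : List (Vertex G)) :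
    anchorStack W d last r a l = anchorStack W F last r a l := by
  induction r using Nat.twoStepInduction generalizing a l with
  | zero => simp [anchorStack]
  | one => simp [anchorStack]
  | more r ih _ =>
    simp only [anchorStack]
    split_ifs with h
    · rfl
    · cases h1 : getAnchor d (r + 2) with
      | some p =>
        rw [getAnchor_eq_some] at h1
        rw [getAnchor_eq_some.2 ⟨h1.1, hd.sub _ _ h1.2⟩]
        dsimp only
        rw [hd.path_iff hF ha]
        split_ifs
        · exact ih (hd.self hF h1.2) _
        · exact ih ha _
      | none =>
        cases h2 : getAnchor F (r + 2) with
        | none => exact ih ha _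
        | some p =>
          rw [getAnchor_eq_some] at h2
          dsimp only
          rw [if_neg]
          · exact ih ha _
          · intro hp
            have h3 := (hd.path_of_path hF ha hp).2
            rw [(hF _ _ h2.2).1] at h3
            rw [getAnchor_eq_some.2 ⟨h2.1, h3⟩] at h1
            cases h1

theorem IsView.mem_anchorStack (hF : WellPlaced F) (hd : IsView W F M d) (last r : ℕ)
    {a : Vertex G} (l : List (Vertex G)) (hl : ∀ v ∈ l, d (v.round, v.source) = some v)
    {v : Vertex G} (hv : v ∈ anchorStack W d last r a l) : d (v.round, v.source) = some v := by
  induction r using Nat.twoStepInduction generalizing a l with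
  | zero => exact hl v (by simpa [anchorStack] using hv)
  | one => exact hl v (by simpa [anchorStack] using hv)
  | more r ih _ =>
    simp only [anchorStack] at hv
    split_ifs at hv with h
    · exact hl v hv
    · cases h1 : getAnchor d (r + 2) with
      | none => rw [h1] at hv; exact ih l hl hv
      | some p =>
        rw [h1] at hv
        dsimp only at hv
        split_ifs at hv with h2
        · refine ih _ (fun v hv => ?_) hv
          rcases List.mem_cons.1 hv with rfl | hv
          · exact hd.self hF (getAnchor_eq_some.1 h1).2
          · exact hl v hv
        · exact ih l hl hv

/-- Walking down from above a decided anchor `v` to the bottom amounts to walking down to `v`, and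
then from `v`. -/
theorem Decided.anchorStack_split (hF : WellPlaced F) (hM : QuorumsMeet W F M) {v : Vertex G}
    (hv : Decided W F M v) (hd : IsView W F M d) (r : ℕ) {a : Vertex G}
    (ha : d (a.round, a.source) = some a) (hr : r + 2 ≤ a.round) (hvr : v.round ≤ r)
    (heven : r % 2 = 0) :
    anchorStack W F 0 r a [] =
      anchorStack W F 0 (v.round - 2) v [v] ++ anchorStack W F v.round r a [] := by
  obtain ⟨dv, hdv, hvd⟩ := hv.inView
  have hvF := hdv.sub _ _ hvd
  have hv1 := (hF _ _ hvF).2.1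
  have hv2 := hv.even
  induction r using Nat.twoStepInduction generalizing a with
  | zero => simp only at hv1; omega
  | one => omega
  | more r ih _ =>
    simp only at hv1
    simp only [anchorStack]
    rw [if_neg (by omega : ¬ r + 2 ≤ 0)]
    by_cases hrv : r + 2 = v.round
    -- The walk arrives at `v`. The walk bounded by `v.round` ends here, while the unbounded one
    -- finds a path to `v` by `Decided.path` and continues from `v`.
    · rw [if_pos (by omega : r + 2 ≤ v.round),
        getAnchor_eq_some.2 (⟨by omega, by rw [hrv, ← hv.source]; exact hvF⟩ :
          (r + 2) % 2 ≠ 1 ∧ F (r + 2, leader G (r + 2)) = some v)]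
      dsimp only
      rw [if_pos (hv.path hF hM hd ha (by omega)), show v.round - 2 = r by omega]
      simp
    · rw [if_neg (by omega : ¬ r + 2 ≤ v.round)]
      cases h : getAnchor F (r + 2) with
      | none => exact ih ha (by omega) (by omega) (by omega)
      | some p =>
        dsimp only
        split_ifs with hp
        · have hpd := (hd.path_of_path hF ha hp).2
          have hpr := (hF _ _ (getAnchor_eq_some.1 h).2).1
          simp only [Prod.mk.injEq] at hpr
          -- The new current anchor `p` has round `r + 2`, so the walk below it again starts two
          -- rounds down.
          rw [anchorStack_append F 0, anchorStack_append F v.round,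
            ih hpd (by omega) (by omega) (by omega), List.append_assoc]
        · exact ih ha (by omega) (by omega) (by omega)

variable (W) in
/-- All anchors that get committed together with or before the decided anchor `v`. -/
noncomputable def chain (F : Dag G) (v : Vertex G) : List (Vertex G) :=
  anchorStack W F 0 (v.round - 2) v [v]

/-- The second part is exactly what a validator with last ordered round `v.round` computes when it
commits `v'`. So it does not matter whether `v` was committed directly before, or only together with
`v'`. -/
theorem Decided.chain_eq (hF : WellPlaced F) (hM : QuorumsMeet W F M) {v v' : Vertex G}
    (hv : Decided W F M v) (hv' : Decided W F M v') (h : v.round < v'.round) :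
    chain W F v' = chain W F v ++ anchorStack W F v.round (v'.round - 2) v' [v'] := by
  obtain ⟨d, hd, hvd⟩ := hv'.inView
  have h1 := hv.even
  have h2 := hv'.even
  rw [chain, anchorStack_append, hv.anchorStack_split hF hM hd (v'.round - 2) hvd
    (by omega) (by omega) (by omega), List.append_assoc, ← anchorStack_append]
  rfl

/-! ### Causal histories and their order. -/

theorem mem_dagVertices {u : Vertex G} :
    u ∈ dagVertices d ↔ ∃ r k, 1 ≤ r ∧ r ≤ G.R ∧ d (r, k) = some u := by
  classical
  simp [dagVertices, and_assoc]

open Classical in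
-- By causal closure an anchor of the view has the same history in `d` and in `F`, and `ord` depends
-- on the set of vertices only.
theorem IsView.orderHistory_eq (hF : WellPlaced F) (hd : IsView W F M d) (ord : HistoryOrder G)
    (l : List (Vertex G)) (hl : ∀ v ∈ l, d (v.round, v.source) = some v)
    (o : List (Vertex G)) : orderHistory W ord d l o = orderHistory W ord F l o := by
  induction l generalizing o with
  | nil => rfl
  | cons a l ih =>
    have ha := hl a (by simp)
    have : ((dagVertices d).filter fun v => PathExists W d a v ∧ v ∉ o) =
        (dagVertices F).filter fun v => PathExists W F a v ∧ v ∉ o := by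
      ext u
      simp only [Finset.mem_filter, mem_dagVertices, hd.path_iff hF ha]
      refine ⟨fun ⟨⟨r, k, h1, h2, h3⟩, h⟩ => ⟨⟨r, k, h1, h2, hd.sub _ _ h3⟩, h⟩,
        fun ⟨⟨r, k, h1, h2, h3⟩, h⟩ => ⟨⟨r, k, h1, h2, ?_⟩, h⟩⟩
      rw [← (hF _ _ h3).1]
      exact (hd.path_of_path hF ha h.1).2
    simp only [orderHistory]
    rw [ih (fun v hv => hl v (by simp [hv]))]
    congr!

theorem orderHistory_append (ord : HistoryOrder G) (d : Dag G) (l₁ l₂ o : List (Vertex G)) :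
    orderHistory W ord d (l₁ ++ l₂) o =
      orderHistory W ord d l₂ (orderHistory W ord d l₁ o) := by
  induction l₁ generalizing o with
  | nil => rfl
  | cons a l ih => exact ih _

theorem prefix_orderHistory (ord : HistoryOrder G) (d : Dag G) (l o : List (Vertex G)) :
    o <+: orderHistory W ord d l o := by
  induction l generalizing o with
  | nil => exact List.prefix_refl _
  | cons a l ih => exact (List.prefix_append _ _).trans (ih _)

open Classical in
theorem orderHistory_nodup (hF : WellPlaced F) (ord : HistoryOrder G) (l o : List (Vertex G))
    (ho : o.Nodup) (ho' : ∀ v ∈ o, F (v.round, v.source) = some v) :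
    (orderHistory W ord F l o).Nodup ∧
      ∀ v ∈ orderHistory W ord F l o, F (v.round, v.source) = some v := by
  induction l generalizing o with
  | nil => exact ⟨ho, ho'⟩
  | cons a l ih =>
    refine ih _ ?_ ?_
    · refine List.nodup_append'.2 ⟨ho, ord.nodup _, fun v hv hv' => ?_⟩
      rw [ord.mem_iff, Finset.mem_filter] at hv'
      exact hv'.2.2 hv
    · intro v hv
      rcases List.mem_append.1 hv with hv | hv
      · exact ho' v hv
      · rw [ord.mem_iff, Finset.mem_filter, mem_dagVertices] at hv
        obtain ⟨⟨r, k, -, -, h⟩, -⟩ := hv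
        rw [(hF _ _ h).1, h]

/-! ### Prefix-comparable outputs and Total order. -/

variable (W) in
/-- The output consists of the histories of the chain of a decided anchor. -/
def OutputInv (ord : HistoryOrder G) (F : Dag G) (M : Set G.vc.Com) (s : PartyState G) : Prop :=
  (s.lastOrderedRound = 0 ∧ s.ordered = []) ∨ ∃ v, Decided W F M v ∧
    s.lastOrderedRound = v.round ∧ s.ordered = orderHistory W ord F (chain W F v) []

/-- Decided anchors of equal rounds coincide, because both occupy the leader's position in `F`. For
different rounds `Decided.chain_eq` extends the chain, and ordering further anchors only appends. -/
theorem prefix_of_lastOrderedRound_le (hF : WellPlaced F) (hM : QuorumsMeet W F M)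
    {ord : HistoryOrder G} {s s' : PartyState G} (hs : OutputInv W ord F M s)
    (hs' : OutputInv W ord F M s') (h : s.lastOrderedRound ≤ s'.lastOrderedRound) :
    s.ordered <+: s'.ordered := by
  rcases hs with ⟨-, ho⟩ | ⟨v, hv, hr, ho⟩
  · rw [ho]; exact List.nil_prefix
  obtain ⟨d, hd, hvd⟩ := hv.inView
  have hvF := hd.sub _ _ hvd
  rcases hs' with ⟨hr', -⟩ | ⟨v', hv', hr', ho'⟩
  · have := (hF _ _ hvF).2.1
    simp only at this
    omega
  rw [ho, ho']
  rcases (show v.round ≤ v'.round by omega).eq_or_lt with h | h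
  · obtain ⟨d', hd', hvd'⟩ := hv'.inView
    have h' := hd'.sub _ _ hvd'
    rw [hv'.source, ← h, ← hv.source, hvF] at h'
    rw [Option.some.inj h']
  · rw [hv.chain_eq hF hM hv' h, orderHistory_append]
    exact prefix_orderHistory _ _ _ _

/-- Since `e` occurs in `l'`, the second relation places it after `e'` there. Comparing the
splittings of `l'` at `e` and at `e'` puts `e'` into the part `l₁` of the prefix, so `e'` is neither
missing from `l` nor, without repetitions, located after `e`. -/
theorem not_outputsBefore_of_prefix {E : Type} {l l' : List E} (hl : l <+: l') (h' : l'.Nodup)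
    {e e' : E} (h : OutputsBefore l e e') : ¬ OutputsBefore l' e' e := by
  rintro ⟨m₁, m₂, hm, h2⟩
  obtain ⟨l₁, l₂, hl1, h1⟩ := h
  obtain ⟨t, ht⟩ := hl
  have he : e ∈ l' := by rw [← ht, hl1]; simp
  have h2 : e ∈ m₂ := h2.resolve_right (fun h => h he)
  have hlt : l₁ ++ e :: (l₂ ++ t) = m₁ ++ e' :: m₂ := by rw [← hm, ← ht, hl1]; simp
  have hn1 : (l₁ ++ e :: (l₂ ++ t)).Nodup := by rw [hlt, ← hm]; exact h'
  have hn2 : (m₁ ++ e' :: m₂).Nodup := by rw [← hm]; exact h'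
  have hee : e' ≠ e := by
    rintro rfl
    have := (List.nodup_append'.1 hn2).2.1
    exact (List.nodup_cons.1 this).1 h2
  have hmem : e' ∈ l₁ := by
    rcases List.append_eq_append_iff.1 hlt with ⟨a, ha, hb⟩ | ⟨a, ha, hb⟩
    · cases a with
      | nil => simp at hb; exact absurd hb.1.symm hee
      | cons x a =>
        simp only [List.cons_append, List.cons.injEq] at hb
        have : e ∈ m₁ := by rw [ha, hb.1]; simp
        exact absurd (List.mem_cons_of_mem e' h2) ((List.nodup_append'.1 hn2).2.2 this)
    · cases a with
      | nil => simp at hb; exact absurd hb.1 hee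
      | cons x a =>
        simp only [List.cons_append, List.cons.injEq] at hb
        rw [ha, hb.1]; simp
  rcases h1 with h1 | h1
  · exact (List.nodup_append'.1 hn1).2.2 hmem (by simp [h1])
  · exact h1 (by rw [hl1]; simp [hmem])

/-- Round and source of an event determine the vertex in `F`, so distinct ordered vertices yield
distinct events and the outputs have no repetitions. -/
theorem totalOrder_of_outputInv (hF : WellPlaced F) (hM : QuorumsMeet W F M)
    {ord : HistoryOrder G} {σ : State G} (h : ∀ i, OutputInv W ord F M (σ.party i)) :
    TotalOrder σ := by
  have hnodup : ∀ i, (σ.outputs i).Nodup := by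
    intro i
    have : (σ.party i).ordered.Nodup ∧
        ∀ v ∈ (σ.party i).ordered, F (v.round, v.source) = some v := by
      rcases h i with ⟨-, ho⟩ | ⟨v, -, -, ho⟩
      · simp [ho]
      · rw [ho]
        exact orderHistory_nodup hF _ _ _ List.nodup_nil (by simp)
    refine List.Nodup.map_on (fun v hv w hw hvw => ?_) this.1
    have h1 := this.2 v hv
    have h2 := this.2 w hw
    simp only [Prod.mk.injEq] at hvw
    rw [hvw.2.1, hvw.2.2, h2] at h1
    exact (Option.some.inj h1).symm
  intro i j _ _ e e' h1 h2
  rcases le_total (σ.party i).lastOrderedRound (σ.party j).lastOrderedRound with hij | hij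
  · exact not_outputsBefore_of_prefix
      ((prefix_of_lastOrderedRound_le hF hM (h i) (h j) hij).map _) (hnodup j) h1 h2
  · exact not_outputsBefore_of_prefix
      ((prefix_of_lastOrderedRound_le hF hM (h j) (h i) hij).map _) (hnodup i) h2 h1

/-! ## Invariants of a local state -/

variable (W) in
/-- The invariant of the local state of a validator. -/
structure PartyInv (ord : HistoryOrder G) (F : Dag G) (M : Set G.vc.Com) (s : PartyState G) :
    Prop where
  view : IsView W F M s.dag
  buffer : ∀ p v, s.buffer p = some v → F p = some v ∧ ValidateSample W v ∧ v.com ∈ M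
  output : OutputInv W ord F M s

theorem PartyInv.init (ord : HistoryOrder G) (F : Dag G) (M : Set G.vc.Com) :
    PartyInv W ord F M (PartyState.init G) :=
  ⟨⟨nofun, nofun, nofun⟩, nofun, .inl ⟨rfl, rfl⟩⟩

theorem IsView.update (hd : IsView W F M d) {p : Pos G} {v : Vertex G}
    (hp : F p = some v) (hv : ValidateSample W v ∧ v.com ∈ M)
    (hc : ∀ x ∈ v.edges, certAt W d (v.round - 1) x.1 = some x.2) :
    IsView W F M (Function.update d p (some v)) := by
  have hsub : ∀ q u, Function.update d p (some v) q = some u → d q = some u ∨ q = p ∧ u = v := by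
    intro q u h
    by_cases hq : q = p
    · subst hq; simp at h; exact .inr ⟨rfl, h.symm⟩
    · rw [Function.update_of_ne hq] at h; exact .inl h
  have hmono : ∀ q u, d q = some u → ∃ u', Function.update d p (some v) q = some u' := by
    intro q u h
    by_cases hq : q = p
    · subst hq; exact ⟨v, by simp⟩
    · exact ⟨u, by rw [Function.update_of_ne hq, h]⟩
  refine ⟨fun q u h => ?_, fun q u h => ?_, fun q u h x hx => certAt_mono W hmono ?_⟩
  · rcases hsub q u h with h | ⟨rfl, rfl⟩
    exacts [hd.sub _ _ h, hp]
  · rcases hsub q u h with h | ⟨rfl, rfl⟩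
    exacts [hd.valid _ _ h, hv]
  · rcases hsub q u h with h | ⟨rfl, rfl⟩
    exacts [hd.closed _ _ h x hx, hc x hx]

/-- Walk and histories may be computed in `F` instead of the local DAG. What is appended then
completes the chain of the previous decided anchor to that of `v`. -/
theorem PartyInv.orderAnchors (hF : WellPlaced F) (hM : QuorumsMeet W F M)
    {ord : HistoryOrder G} {s : PartyState G} (hs : PartyInv W ord F M s) {v : Vertex G}
    (hv : Decided W F M v) (hvd : s.dag (v.round, v.source) = some v) :
    PartyInv W ord F M (orderAnchors W ord s v) := by
  unfold SparseBullshark.orderAnchors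
  split_ifs with hr
  · exact hs
  refine ⟨hs.view, hs.buffer, .inr ⟨v, hv, rfl, ?_⟩⟩
  dsimp only
  rw [hs.view.orderHistory_eq hF ord _ (fun u hu =>
      hs.view.mem_anchorStack hF _ _ _ (by simpa using hvd) hu),
    hs.view.anchorStack_eq hF _ _ hvd]
  rcases hs.output with ⟨h0, ho⟩ | ⟨v₀, hv₀, hr₀, ho⟩
  · rw [h0, ho]; rfl
  · rw [hv₀.chain_eq hF hM hv (by omega), orderHistory_append, ← ho, hr₀]

theorem anchorRef_eq_some {r : ℕ} {a : Ref G} (h : anchorRef W d r = some a) :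
    a = anchorOf W r := by
  unfold anchorRef at h
  split_ifs at h
  obtain ⟨c, hc, rfl⟩ := Option.map_eq_some_iff.1 h
  by_cases hr : r = 0
  · subst hr
    simp [certAt] at hc
    simp [anchorOf, hc]
  · rw [certAt_eq_some_iff W (by omega)] at hc
    rw [anchorOf, hc.2]

open Classical in
theorem IsView.votesFor_le (hd : IsView W F M d) (r : ℕ) :
    votesFor W d r ≤ (voters W F r).card := by
  unfold votesFor
  refine Finset.card_le_card fun k hk => ?_
  rw [Finset.mem_filter] at hk
  obtain ⟨-, v, a, hv, ha, hav⟩ := hk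
  rw [anchorRef_eq_some ha] at hav
  exact mem_voters.2 ⟨v, hd.sub _ _ hv, hav⟩

/-- Votes counted locally are votes in `F`, so the commit rule only fires for decided anchors. -/
theorem PartyInv.insertVertex (hF : WellPlaced F) (hM : QuorumsMeet W F M)
    {ord : HistoryOrder G} {s : PartyState G} (hs : PartyInv W ord F M s) (p : Pos G) :
    PartyInv W ord F M (insertVertex W ord s p) := by
  unfold SparseBullshark.insertVertex
  cases hb : s.buffer p with
  | none => exact hs
  | some v =>
    dsimp only
    split_ifs with hc
    · obtain ⟨hp, hv⟩ := hs.buffer p v hb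
      have hs' : PartyInv W ord F M { s with
          dag := Function.update s.dag p (some v)
          buffer := Function.update s.buffer p none } := by
        refine ⟨hs.view.update hp hv hc, fun q u h => ?_, hs.output⟩
        by_cases hq : q = p
        · subst hq; simp at h
        · exact hs.buffer q u (by simpa [Function.update_of_ne hq] using h)
      have hv1 := hF _ _ hp
      revert hs'
      generalize ({ s with
          dag := Function.update s.dag p (some v)
          buffer := Function.update s.buffer p none } : PartyState G) = s'
      intro hs'
      unfold tryCommitting
      cases ha : getAnchor s'.dag (v.round - 1) with
      | none => exact hs'
      | some a =>
        dsimp only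
        split_ifs with hq
        · obtain ⟨h1, h2⟩ := getAnchor_eq_some.1 ha
          have h3 := hs'.view.pos hF h2
          -- Positions in a view have positive round, so the subtraction in `v.round - 1` is not
          -- truncated.
          have h5 := (hF _ _ (hs'.view.sub _ _ h2)).2.1
          simp only [Prod.mk.injEq] at h3 h5
          refine hs'.orderAnchors hF hM ⟨by omega, by rw [h3.1, h3.2], ?_, ?_⟩
            (hs'.view.self hF h2)
          · rw [show a.round + 1 = v.round by omega]
            exact hq.trans (hs'.view.votesFor_le _)
          · exact ⟨_, hs'.view, hs'.view.self hF h2⟩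
        · exact hs'
    · exact hs

/-- A corrupted source may fix a vertex with a wrong round or source, which is absent from `F`.
Validation rejects it, so membership in `F` is only required for matching data. -/
theorem PartyInv.onDeliver {ord : HistoryOrder G} {s : PartyState G}
    (hs : PartyInv W ord F M s) {v : Vertex G} {r : ℕ} {k : G.Party}
    (hF : v.round = r → v.source = k → F (r, k) = some v) (hM : v.com ∈ M) :
    PartyInv W ord F M (onDeliver W s v r k) := by
  unfold SparseBullshark.onDeliver
  split_ifs with h1 h2
  · exact hs
  · refine ⟨hs.view, fun q u h => ?_, hs.output⟩
    by_cases hq : q = (r, k)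
    · subst hq
      simp at h
      subst h
      exact ⟨hF h2.2.1 h2.1, h2.2.2.2, hM⟩
    · exact hs.buffer q u (by simpa [Function.update_of_ne hq] using h)
  · exact ⟨hs.view, hs.buffer, hs.output⟩

end Ordering

/-! ## Dependence of executions on the random objects -/

section Congruence

variable {G : Setting} {W W' : World G} {d : Dag G}

/-- The worlds have the same certificates at the positions of the genesis and of `d`. -/
def CertsAgree (W W' : World G) (d : Dag G) : Prop :=
  ∀ r k, r = 0 ∨ d (r, k) ≠ none → W.cert k r = W'.cert k r

theorem CertsAgree.certAt (h : CertsAgree W W' d) : certAt W d = certAt W' d := by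
  funext r k
  unfold SparseBullshark.certAt
  split_ifs with hr
  · rw [h 0 k (.inl rfl)]
  · cases hd : d (r, k) with
    | none => rfl
    | some v => simp [h r k (.inr (by simp [hd]))]

theorem CertsAgree.anchorRef (h : CertsAgree W W' d) : anchorRef W d = anchorRef W' d := by
  funext r
  simp only [SparseBullshark.anchorRef, h.certAt]

theorem CertsAgree.votesFor (h : CertsAgree W W' d) : votesFor W d = votesFor W' d := by
  funext r
  unfold SparseBullshark.votesFor
  rw [h.anchorRef]

theorem CertsAgree.votesAgainst (h : CertsAgree W W' d) :
    votesAgainst W d = votesAgainst W' d := by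
  funext r
  unfold SparseBullshark.votesAgainst
  rw [h.anchorRef]

theorem CertsAgree.pathExists (h : CertsAgree W W' d) : PathExists W d = PathExists W' d := by
  have : HasEdge W d = HasEdge W' d := by
    funext v w
    refine propext (and_congr_right fun hw => ?_)
    rw [h w.round w.source (.inr (by simp [hw]))]
  funext v w
  simp only [PathExists, this]

theorem CertsAgree.anchorStack (h : CertsAgree W W' d) (last r : ℕ) (a : Vertex G)
    (l : List (Vertex G)) : anchorStack W d last r a l = anchorStack W' d last r a l := by
  induction r using Nat.twoStepInduction generalizing a l with
  | zero => rfl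
  | one => rfl
  | more r ih _ =>
    simp only [SparseBullshark.anchorStack, ih]
    rw [h.pathExists]

theorem CertsAgree.orderHistory (h : CertsAgree W W' d) (ord : HistoryOrder G)
    (l o : List (Vertex G)) : orderHistory W ord d l o = orderHistory W' ord d l o := by
  induction l generalizing o with
  | nil => rfl
  | cons a l ih =>
    simp only [SparseBullshark.orderHistory, ih]
    rw [h.pathExists]

theorem CertsAgree.tryCommitting {s : PartyState G} (h : CertsAgree W W' s.dag)
    (ord : HistoryOrder G) (v : Vertex G) :
    tryCommitting W ord s v = tryCommitting W' ord s v := by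
  simp only [SparseBullshark.tryCommitting, SparseBullshark.orderAnchors, h.votesFor,
    h.anchorStack, h.orderHistory]

theorem CertsAgree.insertVertex {s : PartyState G} (h : CertsAgree W W' s.dag)
    (hb : CertsAgree W W' s.buffer) (ord : HistoryOrder G) (p : Pos G) :
    insertVertex W ord s p = insertVertex W' ord s p := by
  unfold SparseBullshark.insertVertex
  cases hp : s.buffer p with
  | none => rfl
  | some v =>
    dsimp only
    rw [h.certAt]
    split_ifs with hc
    · refine CertsAgree.tryCommitting (fun r k hrk => ?_) ord v
      rcases hrk with hr | hrk
      · exact h r k (.inl hr)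
      · by_cases hq : (r, k) = p
        · exact hb r k (.inr (by rw [hq, hp]; simp))
        · exact h r k (.inr (by simpa [Function.update_of_ne hq] using hrk))
    · rfl

/-! ### What a single action reads. -/

/-- The vector that validator `i` commits to when it tries to advance. -/
def vecOf (W : World G) (σ : State G) (i : G.Party) : G.Party → Option G.Cert :=
  certAt W (σ.party i).dag (σ.party i).currentRound

/-- The commitment for which an action evaluates `Hash`. -/
def comOf (W : World G) (σ : State G) : Op G → Option G.vc.Com
  | .hash c => some c
  | .advance i _ => some (W.runVC (G.vc.commit (vecOf W σ i)))
  | .deliver _ k r => (σ.fixed (r, k)).map Vertex.com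
  | _ => none

/-- The seed for which an action evaluates the hash functions of ALBA. -/
def seedOf (W : World G) (σ : State G) : Op G → Option G.Seed
  | .albaStep x => some x.1
  | .albaFinal x => some x.1
  | .advance i b => (comOf W σ (.advance i b)).map W.hash
  | .deliver i k r => (comOf W σ (.deliver i k r)).map W.hash
  | _ => none

/-- The hash functions of ALBA agree for the seed `s`. -/
def AlbaAgree (W W' : World G) (s : G.Seed) : Prop :=
  (∀ x : StepInput G, x.1 = s → W.albaStep x = W'.albaStep x) ∧
  ∀ x : FinalInput G, x.1 = s → W.albaFinal x = W'.albaFinal x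

/-- The answers of the vector commitment scheme in an action are the same. -/
def VCAgree (W W' : World G) (σ : State G) : Op G → Prop
  | .vcQuery q => G.vc.oracle W.setup q = G.vc.oracle W'.setup q
  | .advance i _ => W.runVC (G.vc.commit (vecOf W σ i)) = W'.runVC (G.vc.commit (vecOf W σ i)) ∧
      ∀ k, W.runVC (G.vc.prove (vecOf W σ i) k) = W'.runVC (G.vc.prove (vecOf W σ i) k)
  | .deliver _ k r => ∀ v, σ.fixed (r, k) = some v → ∀ t,
      W.runVC (G.vc.verify v.com (v.sample t).1 (some (v.sample t).2) (v.openings t)) =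
        W'.runVC (G.vc.verify v.com (v.sample t).1 (some (v.sample t).2) (v.openings t))
  | _ => True

/-- The worlds agree on everything that an action reads. -/
structure Agree (W W' : World G) (σ : State G) (q : Op G) : Prop where
  certs : CertsAgree W W' σ.fixed
  hash : ∀ c, comOf W σ q = some c → W.hash c = W'.hash c
  alba : ∀ s, seedOf W σ q = some s → AlbaAgree W W' s
  vc : VCAgree W W' σ q

theorem AlbaAgree.albaVerify {s : G.Seed} (h : AlbaAgree W W' s) :
    AlbaVerify W s = AlbaVerify W' s := by
  funext p
  unfold AlbaVerify
  rw [h.2 _ rfl]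
  congr! 4 with k
  exact h.1 _ rfl

/-- Local states contain only vertices fixed by reliable broadcast. -/
structure Covered (σ : State G) : Prop where
  dag : ∀ i p, (σ.party i).dag p ≠ none → σ.fixed p ≠ none
  buffer : ∀ i p, (σ.party i).buffer p ≠ none → σ.fixed p ≠ none

theorem CertsAgree.of_subset {d' : Dag G} (h : CertsAgree W W' d')
    (hd : ∀ p, d p ≠ none → d' p ≠ none) : CertsAgree W W' d :=
  fun r k hrk => h r k (hrk.imp_right (hd _))

theorem Agree.vecOf {σ : State G} {q : Op G} (h : Agree W W' σ q) (hσ : Covered σ)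
    (i : G.Party) : vecOf W σ i = vecOf W' σ i := by
  unfold SparseBullshark.vecOf
  rw [(h.certs.of_subset (hσ.dag i)).certAt]

theorem Agree.comOf_eq {σ : State G} {q : Op G} (h : Agree W W' σ q) (hσ : Covered σ) :
    comOf W σ q = comOf W' σ q := by
  cases q with
  | advance i b => simp only [comOf, ← h.vecOf hσ, h.vc.1]
  | _ => rfl

/-- By `Covered`, local states only involve fixed positions, so no certificate beyond those of fixed
vertices and of the genesis is read. An action touches `Hash` at no more than one commitment and the
ALBA functions at no more than one seed. -/
theorem Agree.step_eq {σ : State G} {q : Op G} (h : Agree W W' σ q) (hσ : Covered σ)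
    (ord : HistoryOrder G) : σ.step W ord q = σ.step W' ord q := by
  cases q with
  | hash c => simp only [State.step, h.hash c rfl]
  | albaStep x => simp only [State.step, (h.alba _ rfl).1 x rfl]
  | albaFinal x => simp only [State.step, (h.alba _ rfl).2 x rfl]
  | vcQuery q => simp only [State.step, show _ = _ from h.vc]
  | readCert k r => simp only [State.step, h.certs.certAt]
  | corrupt k => rfl
  | abcast i b => rfl
  | fix k r v => rfl
  | insert i k r =>
    simp only [State.step, CertsAgree.insertVertex (h.certs.of_subset (hσ.dag i))
      (h.certs.of_subset (hσ.buffer i)) ord (r, k)]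
  | deliver i k r =>
    simp only [State.step]
    cases hv : σ.fixed (r, k) with
    | none => rfl
    | some v =>
      have hc : comOf W σ (.deliver i k r) = some v.com := by simp [comOf, hv]
      have : ValidateVertex W v r k = ValidateVertex W' v r k := by
        unfold ValidateVertex ValidateSample
        rw [← h.hash _ hc, (h.alba (W.hash v.com) (by rw [seedOf, hc]; rfl)).albaVerify]
        simp only [h.vc v hv]
      simp only [onDeliver]
      rw [this]
  | advance i b =>
    have hd := h.certs.of_subset (hσ.dag i)
    have hc : comOf W σ (.advance i b) =
      some (W.runVC (G.vc.commit (certAt W (σ.party i).dag (σ.party i).currentRound))) := rfl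
    have h1 := h.hash _ hc
    have h2 := (h.alba (W.hash _) (by rw [seedOf, hc]; rfl)).albaVerify
    have hvc := h.vc
    simp only [VCAgree, SparseBullshark.vecOf] at hvc
    have : tryAdvance W i (σ.party i) b = tryAdvance W' i (σ.party i) b := by
      have hm : MayAdvanceRound W (σ.party i) b = MayAdvanceRound W' (σ.party i) b := by
        simp only [MayAdvanceRound, hd.certAt, hd.anchorRef, hd.votesFor, hd.votesAgainst]
      have hp : albaProve W (W.hash (W.runVC (G.vc.commit
          (certAt W (σ.party i).dag (σ.party i).currentRound)))) =
          albaProve W' (W.hash (W.runVC (G.vc.commit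
          (certAt W (σ.party i).dag (σ.party i).currentRound)))) := by
        funext S
        unfold albaProve
        rw [h2]
      have hn : ∀ bl, createNewVertex W i (σ.party i).dag ((σ.party i).currentRound + 1) bl =
          createNewVertex W' i (σ.party i).dag ((σ.party i).currentRound + 1) bl := by
        intro bl
        -- The vertex of round `currentRound + 1` commits to round `currentRound + 1 - 1`, the round
        -- of `vecOf`.
        simp only [createNewVertex, Nat.add_sub_cancel, hp, hvc.2]
        rw [h1, hvc.1, hd.certAt, hd.anchorRef]
      simp only [tryAdvance, hn]
      rw [hm]
    simp only [State.step, this]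

theorem Covered.init : Covered (State.init G) :=
  ⟨fun _ _ h => absurd rfl h, fun _ _ h => absurd rfl h⟩

/-! ### Invariants of the steps. -/

theorem step_fixed_mono (W : World G) (ord : HistoryOrder G) (σ : State G) (q : Op G) {p : Pos G}
    {v : Vertex G} (h : σ.fixed p = some v) : (σ.step W ord q).1.fixed p = some v := by
  cases q with
  | corrupt k => simp only [State.step]; split_ifs <;> exact h
  | advance i b => simp only [State.step]; split <;> exact h
  | deliver i k r => simp only [State.step]; split <;> exact h
  | fix k r u =>
    simp only [State.step]
    split_ifs with hc
    · by_cases hp : p = (r, k)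
      · subst hp; rw [hc.1] at h; cases h
      · simpa [Function.update_of_ne hp] using h
    · exact h
  | _ => exact h

theorem step_fixed_round (W : World G) (ord : HistoryOrder G) (σ : State G) (q : Op G)
    (h : ∀ p, σ.fixed p ≠ none → 1 ≤ p.1 ∧ p.1 ≤ G.R) :
    ∀ p, (σ.step W ord q).1.fixed p ≠ none → 1 ≤ p.1 ∧ p.1 ≤ G.R := by
  intro p
  cases q with
  | corrupt k => simp only [State.step]; split_ifs <;> exact h p
  | advance i b => simp only [State.step]; split <;> exact h p
  | deliver i k r => simp only [State.step]; split <;> exact h p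
  | fix k r u =>
    simp only [State.step]
    split_ifs with hc
    · by_cases hp : p = (r, k)
      · subst hp; exact fun _ => ⟨hc.2.1, hc.2.2.1⟩
      · simpa [Function.update_of_ne hp] using h p
    · exact h p
  | _ => exact h p

theorem tryCommitting_dag (ord : HistoryOrder G) (s : PartyState G) (v : Vertex G) :
    (tryCommitting W ord s v).dag = s.dag ∧ (tryCommitting W ord s v).buffer = s.buffer := by
  unfold tryCommitting
  split
  · exact ⟨rfl, rfl⟩
  · unfold orderAnchors
    split_ifs <;> exact ⟨rfl, rfl⟩

theorem insertVertex_subset (ord : HistoryOrder G) (s : PartyState G) (p q : Pos G) :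
    ((insertVertex W ord s p).dag q ≠ none → s.dag q ≠ none ∨ s.buffer q ≠ none) ∧
      ((insertVertex W ord s p).buffer q ≠ none → s.buffer q ≠ none) := by
  unfold insertVertex
  cases hp : s.buffer p with
  | none => exact ⟨.inl, id⟩
  | some v =>
    dsimp only
    split_ifs
    · rw [(tryCommitting_dag _ _ _).1, (tryCommitting_dag _ _ _).2]
      by_cases hq : q = p
      · subst hq; simp [hp]
      · simp only [Function.update_of_ne hq]
        exact ⟨.inl, id⟩
    · exact ⟨.inl, id⟩

theorem onDeliver_subset (s : PartyState G) (v : Vertex G) (r : ℕ) (k : G.Party) (q : Pos G) :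
    (onDeliver W s v r k).dag = s.dag ∧
      ((onDeliver W s v r k).buffer q ≠ none → s.buffer q ≠ none ∨ q = (r, k)) := by
  unfold onDeliver
  split_ifs
  · exact ⟨rfl, .inl⟩
  · refine ⟨rfl, fun h => ?_⟩
    by_cases hq : q = (r, k)
    · exact .inr hq
    · exact .inl (by simpa [Function.update_of_ne hq] using h)
  · exact ⟨rfl, .inl⟩

theorem tryAdvance_eq {i : G.Party} {s : PartyState G} {b : Bool} :
    (tryAdvance W i s b).1.dag = s.dag ∧ (tryAdvance W i s b).1.buffer = s.buffer ∧
      (tryAdvance W i s b).1.lastOrderedRound = s.lastOrderedRound ∧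
      (tryAdvance W i s b).1.ordered = s.ordered := by
  unfold tryAdvance
  split
  · simp
  · split_ifs
    · split <;> simp
    · simp

theorem forall_update_party {σ : State G} {i : G.Party} {s : PartyState G}
    {P : PartyState G → Prop} (h : ∀ j, P (σ.party j)) (hs : P s) (j : G.Party) :
    P (Function.update σ.party i s j) := by
  by_cases hj : j = i
  · subst hj; simpa using hs
  · simpa [Function.update_of_ne hj] using h j

theorem Covered.step {σ : State G} (h : Covered σ) (ord : HistoryOrder G) (q : Op G) :
    Covered (σ.step W ord q).1 := by
  have hP : ∀ j, (∀ p, (σ.party j).dag p ≠ none → σ.fixed p ≠ none) ∧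
      ∀ p, (σ.party j).buffer p ≠ none → σ.fixed p ≠ none := fun j => ⟨h.dag j, h.buffer j⟩
  have key : ∀ (i : G.Party) (s : PartyState G), ((∀ p, s.dag p ≠ none → σ.fixed p ≠ none) ∧
      ∀ p, s.buffer p ≠ none → σ.fixed p ≠ none) → ∀ σ' : State G,
      σ'.party = Function.update σ.party i s → σ'.fixed = σ.fixed → Covered σ' := by
    intro i s hs σ' hp hf
    have := forall_update_party (i := i) (P := fun s => (∀ p, s.dag p ≠ none → σ.fixed p ≠ none) ∧
      ∀ p, s.buffer p ≠ none → σ.fixed p ≠ none) hP hs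
    rw [← hp] at this
    exact ⟨fun j p => by rw [hf]; exact (this j).1 p, fun j p => by rw [hf]; exact (this j).2 p⟩
  cases q with
  | corrupt k => simp only [State.step]; split_ifs <;> exact ⟨h.dag, h.buffer⟩
  | abcast i b =>
    exact key i { σ.party i with blocksToPropose := (σ.party i).blocksToPropose ++ [b] } (hP i)
      _ rfl rfl
  | fix k r u =>
    have : ∀ p, σ.fixed p ≠ none → (σ.step W ord (.fix k r u)).1.fixed p ≠ none := fun p hp => by
      obtain ⟨v, hv⟩ := Option.ne_none_iff_exists'.1 hp
      exact Option.ne_none_iff_exists'.2 ⟨v, step_fixed_mono W ord σ (.fix k r u) hv⟩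
    have hparty : (σ.step W ord (.fix k r u)).1.party = σ.party := by
      simp only [State.step]; split_ifs <;> rfl
    exact ⟨fun i p hp => this p (h.dag i p (by rwa [hparty] at hp)),
      fun i p hp => this p (h.buffer i p (by rwa [hparty] at hp))⟩
  | advance i b =>
    simp only [State.step]
    split
    · exact h
    · rename_i s v heq
      have he := tryAdvance_eq (W := W) (i := i) (s := σ.party i) (b := b)
      rw [heq] at he
      refine key i s ⟨?_, ?_⟩ _ rfl rfl
      · rw [he.1]; exact h.dag i
      · rw [he.2.1]; exact h.buffer i
  | deliver i k r =>
    simp only [State.step]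
    split
    · exact h
    · rename_i v hv
      refine key i _ ⟨fun p => ?_, fun p hp => ?_⟩ _ rfl rfl
      · rw [(onDeliver_subset _ _ _ _ p).1]; exact h.dag i p
      · rcases (onDeliver_subset _ _ _ _ p).2 hp with hp | rfl
        · exact h.buffer i p hp
        · simp [hv]
  | insert i k r =>
    refine key i _ ⟨fun p hp => ?_, fun p hp => ?_⟩ _ rfl rfl
    · exact ((insertVertex_subset _ _ _ p).1 hp).elim (h.dag i p) (h.buffer i p)
    · exact h.buffer i p ((insertVertex_subset _ _ _ p).2 hp)
  | _ => exact h

/-! ## Configurations -/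

/-- What the adversary is going to do, and the state. -/
abbrev Config (G : Setting) : Type := Prog (Op G) (Resp G) Unit × State G

/-- One step of an execution. -/
noncomputable def Config.step (W : World G) (ord : HistoryOrder G) : Config G → Config G
  | (.ret x, σ) => (.ret x, σ)
  | (.ask q next, σ) => (next (σ.step W ord q).2, (σ.step W ord q).1)

/-- The commitment for which the next action evaluates `Hash`. -/
def Config.com (W : World G) : Config G → Option G.vc.Com
  | (.ret _, _) => none
  | (.ask q _, σ) => comOf W σ q

/-- The seed for which the next action evaluates the hash functions of ALBA. -/
def Config.seed (W : World G) : Config G → Option G.Seed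
  | (.ret _, _) => none
  | (.ask q _, σ) => seedOf W σ q

/-- The worlds agree on everything that the next action reads. -/
def Config.Agree (W W' : World G) : Config G → Prop
  | (.ret _, _) => True
  | (.ask q _, σ) => SparseBullshark.Agree W W' σ q

/-- The configuration after `t` steps. -/
noncomputable def conf (ord : HistoryOrder G) (P : Prog (Op G) (Resp G) Unit) (W : World G)
    (t : ℕ) : Config G :=
  (Config.step W ord)^[t] (P, State.init G)

variable {ord : HistoryOrder G} {P : Prog (Op G) (Resp G) Unit}

theorem conf_succ (t : ℕ) : conf ord P W (t + 1) = (conf ord P W t).step W ord :=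
  Function.iterate_succ_apply' _ _ _

/-- A finished program leaves its configuration unchanged, so `T` iterations cover every program
with at most `T` requests. -/
theorem run_eq_conf {T : ℕ} (h : P.Bounded T) :
    State.run W ord (State.init G) P = (conf ord P W T).2 := by
  unfold conf
  generalize State.init G = σ
  induction T generalizing P σ with
  | zero =>
    cases P with
    | ret x => rfl
    | ask q next => exact h.elim
  | succ T ih =>
    cases P with
    | ret x =>
      have : ∀ t, (Config.step W ord)^[t] (.ret x, σ) = (.ret x, σ) := fun t =>
        Function.iterate_fixed rfl t
      rw [this]; rfl
    | ask q next =>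
      rw [Function.iterate_succ_apply]
      exact ih (h _) _

theorem conf_induction {Q : State G → Prop} (h0 : Q (State.init G))
    (hs : ∀ σ q, Q σ → Q (σ.step W ord q).1) (t : ℕ) : Q (conf ord P W t).2 := by
  induction t with
  | zero => exact h0
  | succ t ih =>
    rw [conf_succ]
    revert ih
    obtain ⟨p, σ⟩ := conf ord P W t
    intro ih
    cases p with
    | ret x => exact ih
    | ask q next => exact hs _ _ ih

theorem covered_conf (t : ℕ) : Covered (conf ord P W t).2 :=
  conf_induction Covered.init (fun _ q h => h.step ord q) t

theorem conf_fixed_round (t : ℕ) : ∀ p, (conf ord P W t).2.fixed p ≠ none → 1 ≤ p.1 ∧ p.1 ≤ G.R :=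
  conf_induction (Q := fun σ => ∀ p, σ.fixed p ≠ none → 1 ≤ p.1 ∧ p.1 ≤ G.R)
    (fun _ h => absurd rfl h) (fun σ q h => step_fixed_round W ord σ q h) t

theorem conf_fixed_mono {t u : ℕ} (htu : t ≤ u) {p : Pos G} {v : Vertex G}
    (h : (conf ord P W t).2.fixed p = some v) : (conf ord P W u).2.fixed p = some v := by
  induction u, htu using Nat.le_induction with
  | base => exact h
  | succ u _ ih =>
    rw [conf_succ]
    revert ih
    obtain ⟨p, σ⟩ := conf ord P W u
    intro ih
    cases p with
    | ret x => exact ih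
    | ask q next => exact step_fixed_mono _ _ _ _ ih

/-- The basis of all resampling arguments. Agreement is required only on what is read in the world
`W`: as long as the executions coincide, `W'` is read at the same places. -/
theorem conf_eq_of_agree {t : ℕ} (h : ∀ u < t, (conf ord P W u).Agree W W') :
    conf ord P W t = conf ord P W' t := by
  induction t with
  | zero => rfl
  | succ t ih =>
    have h1 := ih fun u hu => h u (by omega)
    have h2 := h t (by omega)
    have h3 := covered_conf (ord := ord) (P := P) (W := W) t
    rw [conf_succ, conf_succ, ← h1]
    revert h2 h3
    obtain ⟨p, σ⟩ := conf ord P W t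
    intro h2 h3
    cases p with
    | ret x => rfl
    | ask q next => simp only [Config.step, Agree.step_eq h2 h3]

end Congruence

/-! ## Attacks -/

section Attacks

variable {G : Setting} (ord : HistoryOrder G) (P : Prog (Op G) (Resp G) Unit) (W : World G)

/-- `Hash` is evaluated at `c` in step `t` for the first time. -/
def FirstCom (t : ℕ) (c : G.vc.Com) : Prop :=
  (conf ord P W t).com W = some c ∧ ∀ u < t, (conf ord P W u).com W ≠ some c

/-- `Hash` takes the value `s` in step `t`, and the hash functions of ALBA have not been evaluated
for the seed `s` before. -/
def FreshSeed (t : ℕ) (s : G.Seed) : Prop :=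
  (∃ c, (conf ord P W t).com W = some c ∧ W.hash c = s) ∧
    ∀ u < t, (conf ord P W u).seed W ≠ some s

/-- A new value of `Hash` is a seed that has been used for ALBA before. -/
def SeedReused (t : ℕ) : Prop :=
  ∃ c, FirstCom ord P W t c ∧ ∃ u < t, (conf ord P W u).seed W = some (W.hash c)

open Classical in
/-- The validators with a vertex of round `r` that does not reference the anchor of round
`r - 1`. -/
noncomputable def nonVoters (F : Dag G) (r : ℕ) : Finset G.Party :=
  Finset.univ.filter fun k => ∃ u, F (r, k) = some u ∧ anchorOf W (r - 1) ∉ u.edges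

open Classical in
/-- References to the vertices of round `r` that do not reference the anchor of round `r - 1`. -/
noncomputable def nonVoterRefs (F : Dag G) (r : ℕ) : Finset (Ref G) :=
  (nonVoters W F r).image fun k => (k, W.cert k r)

/-- For a fresh seed, there is an ALBA proof with elements in the set of at most `f` references to
vertices that do not vote. -/
def SampleEscapes (t r : ℕ) : Prop :=
  ∃ s, FreshSeed ord P W t s ∧ (nonVoterRefs W (conf ord P W t).2.fixed r).card ≤ G.f ∧
    ∃ p : AlbaProof G, (∀ j, p.2 j ∈ nonVoterRefs W (conf ord P W t).2.fixed r) ∧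
      AlbaVerify W s p

/-- In the end, after `T` steps, the vertex of round `r + 1` and source `k'` opens its commitment,
which was hashed in step `t`, to the certificate of a vertex that was not yet fixed in step `t`. -/
def PrematureOpening (T t r : ℕ) (k k' : G.Party) (j : Fin G.D) : Prop :=
  ∃ w, (conf ord P W T).2.fixed (r + 1, k') = some w ∧
    (conf ord P W t).com W = some w.com ∧ (conf ord P W t).2.fixed (r, k) = none ∧
    w.sample j = (k, W.cert k r) ∧
    W.runVC (G.vc.verify w.com k (some (W.cert k r)) (w.openings j)) = true

open Classical in
/-- The vertices of `F` that are stored at their own position. -/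
noncomputable def wellPlacedPart (F : Dag G) : Dag G :=
  fun p => (F p).filter fun v => decide ((v.round, v.source) = p)

variable {ord P W}

theorem wellPlacedPart_eq_some {F : Dag G} {p : Pos G} {v : Vertex G} :
    wellPlacedPart F p = some v ↔ F p = some v ∧ (v.round, v.source) = p := by
  simp [wellPlacedPart, Option.filter_eq_some_iff]

theorem mem_nonVoters {F : Dag G} {r : ℕ} {k : G.Party} :
    k ∈ nonVoters W F r ↔ ∃ u, F (r, k) = some u ∧ anchorOf W (r - 1) ∉ u.edges := by
  classical simp [nonVoters]

/-! ### From a failed intersection to an attack. -/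

variable (ord P W) in
/-- All commitments for which `Hash` is evaluated within `T` steps. -/
def hashedComs (T : ℕ) : Set G.vc.Com := {c | ∃ u < T, (conf ord P W u).com W = some c}

theorem wellPlaced_conf (T : ℕ) : WellPlaced (wellPlacedPart (conf ord P W T).2.fixed) := by
  intro p v h
  rw [wellPlacedPart_eq_some] at h
  exact ⟨h.2, conf_fixed_round T p (by rw [h.1]; simp)⟩

theorem partyInv_step {F : Dag G} {M : Set G.vc.Com} (hF : WellPlaced F)
    (hM : QuorumsMeet W F M) {σ : State G} (hσ : ∀ i, PartyInv W ord F M (σ.party i)) {q : Op G}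
    (hcom : ∀ c, comOf W σ q = some c → c ∈ M)
    (hfixed : ∀ p v, σ.fixed p = some v → (v.round, v.source) = p → F p = some v) (i : G.Party) :
    PartyInv W ord F M ((σ.step W ord q).1.party i) := by
  cases q with
  | corrupt k => simp only [State.step]; split_ifs <;> exact hσ i
  | fix k r v => simp only [State.step]; split_ifs <;> exact hσ i
  | abcast j b =>
    exact forall_update_party
      (s := { σ.party j with blocksToPropose := (σ.party j).blocksToPropose ++ [b] }) hσ
      ⟨(hσ j).view, (hσ j).buffer, (hσ j).output⟩ i
  | advance j b =>
    simp only [State.step]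
    split
    · exact hσ i
    · rename_i s v heq
      obtain ⟨h1, h2, h3, h4⟩ := tryAdvance_eq (W := W) (i := j) (s := σ.party j) (b := b)
      rw [heq] at h1 h2 h3 h4
      dsimp only at h1 h2 h3 h4
      refine forall_update_party hσ ⟨?_, ?_, ?_⟩ i
      · rw [h1]; exact (hσ j).view
      · rw [h2]; exact (hσ j).buffer
      · unfold OutputInv
        rw [h3, h4]; exact (hσ j).output
  | deliver j k r =>
    simp only [State.step]
    split
    · exact hσ i
    · rename_i v hv
      exact forall_update_party hσ ((hσ j).onDeliver
        (fun h1 h2 => hfixed _ _ hv (by rw [h1, h2])) (hcom _ (by simp [comOf, hv]))) i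
  | insert j k r => exact forall_update_party hσ ((hσ j).insertVertex hF hM _) i
  | _ => exact hσ i

/-- The invariant refers throughout to the vertices fixed and the commitments hashed by the final
step `T`, so intermediate states only need that both grow. -/
theorem partyInv_conf {T : ℕ} (hM : QuorumsMeet W (wellPlacedPart (conf ord P W T).2.fixed)
    (hashedComs ord P W T)) {t : ℕ} (ht : t ≤ T) (i : G.Party) :
    PartyInv W ord (wellPlacedPart (conf ord P W T).2.fixed) (hashedComs ord P W T)
      ((conf ord P W t).2.party i) := by
  have hF := wellPlaced_conf (ord := ord) (P := P) (W := W) T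
  induction t generalizing i with
  | zero => exact PartyInv.init _ _ _
  | succ t ih =>
    have ih := fun i => ih (by omega) i
    have hmem : ∀ c, (conf ord P W t).com W = some c → c ∈ hashedComs ord P W T :=
      fun c hc => ⟨t, ht, hc⟩
    have hfixed : ∀ p v, (conf ord P W t).2.fixed p = some v → (v.round, v.source) = p →
        wellPlacedPart (conf ord P W T).2.fixed p = some v :=
      fun p v h h' => wellPlacedPart_eq_some.2 ⟨conf_fixed_mono (by omega) h, h'⟩
    rw [conf_succ]
    revert hfixed hF hM ih hmem
    generalize wellPlacedPart (conf ord P W T).2.fixed = F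
    generalize hashedComs ord P W T = M
    obtain ⟨p, σ⟩ := conf ord P W t
    intro hM hF ih hmem hfixed
    cases p with
    | ret x => exact ih i
    | ask q next => exact partyInv_step hF hM ih hmem hfixed i

theorem not_quorumsMeet {T : ℕ}
    (h : ¬ QuorumsMeet W (wellPlacedPart (conf ord P W T).2.fixed) (hashedComs ord P W T)) :
    (∃ t < T, SeedReused ord P W t) ∨ (∃ t < T, ∃ r ≤ G.R, SampleEscapes ord P W t r) ∨
      ∃ t < T, ∃ r, 1 ≤ r ∧ r ≤ G.R ∧ ∃ k k' j, PrematureOpening ord P W T t r k k' j := by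
  classical
  unfold QuorumsMeet at h
  push Not at h
  obtain ⟨w, r, hr, hw, hwr, hval, ⟨t, ht, hcom⟩, hpar, hquorum, hno⟩ := h
  -- The first evaluation of `Hash` at the commitment of `w`: from here on its seed is known.
  obtain ⟨t, ⟨ht, hcom⟩, hmin⟩ : ∃ t, (t < T ∧ (conf ord P W t).com W = some w.com) ∧
      ∀ u < t, ¬ (u < T ∧ (conf ord P W u).com W = some w.com) :=
    have hex : ∃ t, t < T ∧ (conf ord P W t).com W = some w.com := ⟨t, ht, hcom⟩
    ⟨_, Nat.find_spec hex, fun u => Nat.find_min hex⟩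
  have hfirst : FirstCom ord P W t w.com := ⟨hcom, fun u hu h => hmin u hu ⟨by omega, h⟩⟩
  by_cases hreuse : ∃ u < t, (conf ord P W u).seed W = some (W.hash w.com)
  · exact .inl ⟨t, ht, _, hfirst, hreuse⟩
  push Not at hreuse
  have hwF := (wellPlacedPart_eq_some.1 hw).1
  have hR : r + 1 ≤ G.R := (conf_fixed_round T _ (by rw [hwF]; simp)).2
  have hmemE : ∀ j, w.sample j ∈ w.edges := fun j =>
    Finset.mem_union_left _ (Finset.mem_image_of_mem _ (Finset.mem_univ _))
  have hpar' := fun j => (certAt_eq_some_iff W hr).1 (hpar _ (hmemE j))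
  by_cases hpre : ∃ j, (conf ord P W t).2.fixed (r, (w.sample j).1) = none
  · obtain ⟨j, hj⟩ := hpre
    refine .inr (.inr ⟨t, ht, r, hr, by omega, (w.sample j).1, w.source, j, w, hwF, hcom, hj,
      ?_, ?_⟩)
    · rw [← (hpar' j).2]
    · rw [← (hpar' j).2]; exact hval.1 j
  · push Not at hpre
    refine .inr (.inl ⟨t, ht, r, by omega, W.hash w.com, ⟨⟨_, hcom, rfl⟩, hreuse⟩, ?_,
      (w.start, w.sample), fun j => ?_, hval.2⟩)
    · refine Finset.card_image_le.trans ?_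
      -- An instance is fixed only once, so a non-voter at step `t` is no voter at the end. Besides
      -- the `2f + 1` voters at most `f` of the `3f + 1` validators remain.
      have hdisj : Disjoint (nonVoters W (conf ord P W t).2.fixed r)
          (voters W (wellPlacedPart (conf ord P W T).2.fixed) r) := by
        rw [Finset.disjoint_left]
        intro k hk hk'
        obtain ⟨u, hu, ha⟩ := mem_nonVoters.1 hk
        obtain ⟨u', hu', ha'⟩ := mem_voters.1 hk'
        have h1 := conf_fixed_mono (show t ≤ T by omega) hu
        rw [(wellPlacedPart_eq_some.1 hu').1] at h1
        rw [Option.some.inj h1] at ha'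
        exact ha ha'
      have h1 := Finset.card_union_of_disjoint hdisj
      have h2 := Finset.card_le_univ (nonVoters W (conf ord P W t).2.fixed r ∪
          voters W (wellPlacedPart (conf ord P W T).2.fixed) r)
      rw [Fintype.card_fin] at h2
      have h3 : G.n = 3 * G.f + 1 := rfl
      omega
    · obtain ⟨u, hu⟩ := Option.ne_none_iff_exists'.1 (hpre j)
      refine Finset.mem_image.2 ⟨(w.sample j).1, mem_nonVoters.2 ⟨u, hu, fun ha => ?_⟩, ?_⟩
      · obtain ⟨⟨u', hu'⟩, -⟩ := hpar' j
        have h1 := conf_fixed_mono (show t ≤ T by omega) hu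
        rw [(wellPlacedPart_eq_some.1 hu').1] at h1
        refine hno _ (hmemE j) (mem_voters.2 ⟨u', hu', ?_⟩)
        rw [Option.some.inj h1]
        exact ha
      · rw [← (hpar' j).2]

/-- A violation of Total order requires one of the attacks. -/
theorem attack_of_not_totalOrder {T : ℕ} (hP : P.Bounded T)
    (h : ¬ TotalOrder (State.run W ord (State.init G) P)) :
    (∃ t < T, SeedReused ord P W t) ∨ (∃ t < T, ∃ r ≤ G.R, SampleEscapes ord P W t r) ∨
      ∃ t < T, ∃ r, 1 ≤ r ∧ r ≤ G.R ∧ ∃ k k' j, PrematureOpening ord P W T t r k k' j := by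
  refine not_quorumsMeet fun hM => h ?_
  rw [run_eq_conf hP]
  exact totalOrder_of_outputInv (wellPlaced_conf T) hM fun i => (partyInv_conf hM le_rfl i).output

end Attacks

open scoped ENNReal

/-! ## Averages over finite types -/

section Average

variable {Ω Ω' : Type} [Finite Ω] [Finite Ω']

/-- The expectation of a function on a finite type with the uniform distribution. -/
noncomputable def avg (g : Ω → ℝ≥0∞) : ℝ≥0∞ :=
  letI := Fintype.ofFinite Ω
  (Fintype.card Ω : ℝ≥0∞)⁻¹ * ∑ x, g x

theorem avg_eq {Ω : Type} [Fintype Ω] (g : Ω → ℝ≥0∞) :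
    avg g = (Fintype.card Ω : ℝ≥0∞)⁻¹ * ∑ x, g x := by
  rw [avg, Subsingleton.elim (Fintype.ofFinite Ω) ‹Fintype Ω›]

open Classical in
/-- The indicator of a proposition. -/
noncomputable def ind (p : Prop) : ℝ≥0∞ := if p then 1 else 0

theorem ind_mono {p q : Prop} (h : p → q) : ind p ≤ ind q := by
  unfold ind
  split_ifs <;> simp_all

theorem ind_le_one (p : Prop) : ind p ≤ 1 := by
  unfold ind
  split_ifs <;> simp

theorem ind_exists_le {ι : Type} (s : Finset ι) (p : ι → Prop) :
    ind (∃ i ∈ s, p i) ≤ ∑ i ∈ s, ind (p i) := by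
  by_cases h : ∃ i ∈ s, p i
  · obtain ⟨i, hi, hp⟩ := h
    refine (ind_le_one _).trans (le_trans ?_ (Finset.single_le_sum (fun _ _ => zero_le) hi))
    simp [ind, hp]
  · simp [ind, h]

theorem ind_or_le (p q : Prop) : ind (p ∨ q) ≤ ind p + ind q := by
  unfold ind
  split_ifs <;> simp_all

theorem ind_and (p q : Prop) : ind (p ∧ q) = ind p * ind q := by
  unfold ind
  split_ifs <;> simp_all

theorem avg_mono {g g' : Ω → ℝ≥0∞} (h : ∀ x, g x ≤ g' x) : avg g ≤ avg g' :=
  mul_le_mul_right (Finset.sum_le_sum fun x _ => h x) _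

theorem avg_add (g g' : Ω → ℝ≥0∞) : avg (fun x => g x + g' x) = avg g + avg g' := by
  simp [avg, Finset.sum_add_distrib, mul_add]

theorem avg_sum {ι : Type} (s : Finset ι) (g : ι → Ω → ℝ≥0∞) :
    avg (fun x => ∑ i ∈ s, g i x) = ∑ i ∈ s, avg (g i) := by
  simp only [avg, Finset.mul_sum]
  rw [Finset.sum_comm]

theorem avg_const_mul (a : ℝ≥0∞) (g : Ω → ℝ≥0∞) : avg (fun x => a * g x) = a * avg g := by
  simp only [avg, ← Finset.mul_sum]
  ring

theorem avg_mul_const (a : ℝ≥0∞) (g : Ω → ℝ≥0∞) : avg (fun x => g x * a) = avg g * a := by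
  simp only [mul_comm _ a, avg_const_mul]

theorem avg_const [Nonempty Ω] (a : ℝ≥0∞) : avg (fun _ : Ω => a) = a := by
  cases nonempty_fintype Ω
  simp only [avg_eq, Finset.sum_const, nsmul_eq_mul, Finset.card_univ]
  rw [← mul_assoc, ENNReal.inv_mul_cancel (by simp) (by simp), one_mul]

theorem avg_le_const (a : ℝ≥0∞) {g : Ω → ℝ≥0∞} (h : ∀ x, g x ≤ a) : avg g ≤ a := by
  cases isEmpty_or_nonempty Ω
  · cases nonempty_fintype Ω
    simp [avg_eq]
  · exact (avg_mono h).trans_eq (avg_const a)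

theorem avg_equiv (e : Ω ≃ Ω') (g : Ω' → ℝ≥0∞) : avg (fun x => g (e x)) = avg g := by
  cases nonempty_fintype Ω
  cases nonempty_fintype Ω'
  simp only [avg_eq, Fintype.card_congr e, e.sum_comp]

theorem avg_prod (g : Ω × Ω' → ℝ≥0∞) : avg g = avg fun x => avg fun y => g (x, y) := by
  cases nonempty_fintype Ω
  cases nonempty_fintype Ω'
  simp only [avg_eq, Fintype.sum_prod_type, Fintype.card_prod, Nat.cast_mul, Finset.mul_sum]
  refine Finset.sum_congr rfl fun x _ => Finset.sum_congr rfl fun y _ => ?_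
  rw [← mul_assoc, ENNReal.mul_inv (by simp) (by simp)]

theorem sum_ind {Ω : Type} [Fintype Ω] (p : Ω → Prop) [DecidablePred p] :
    ∑ x, ind (p x) = ((Finset.univ.filter p).card : ℝ≥0∞) := by
  rw [← Finset.sum_boole]
  refine Finset.sum_congr rfl fun x _ => ?_
  unfold ind
  congr

theorem uniform_toOuterMeasure {Ω : Type} [Fintype Ω] [Nonempty Ω] (p : Ω → Prop) :
    (PMF.uniformOfFintype Ω).toOuterMeasure {x | p x} = avg fun x => ind (p x) := by
  classical
  rw [PMF.toOuterMeasure_apply, tsum_fintype, avg_eq, Finset.mul_sum]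
  refine Finset.sum_congr rfl fun x _ => ?_
  simp [Set.indicator, ind]

/-- A uniformly random function takes prescribed values at the points of `K`. -/
theorem avg_pi_eq {I V : Type} [Fintype I] [DecidableEq I] [Fintype V] [Nonempty V]
    (K : Finset I) (v : I → V) :
    avg (fun g : I → V => ind (∀ i ∈ K, g i = v i)) =
      ((Fintype.card V : ℝ≥0∞) ^ K.card)⁻¹ := by
  classical
  have h1 : ∑ g : I → V, ind (∀ i ∈ K, g i = v i) =
      ((Fintype.card V ^ (Fintype.card I - K.card) : ℕ) : ℝ≥0∞) := by
    rw [sum_ind]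
    congr 1
    -- The functions form a box: one value at each point of `K`, all values elsewhere.
    have : (Finset.univ.filter fun g : I → V => ∀ i ∈ K, g i = v i) =
        Fintype.piFinset fun i => if i ∈ K then {v i} else Finset.univ := by
      ext g
      simp only [Finset.mem_filter, Finset.mem_univ, true_and, Fintype.mem_piFinset]
      refine forall_congr' fun i => ?_
      split_ifs with h <;> simp [h]
    rw [this, Fintype.card_piFinset]
    simp only [apply_ite Finset.card, Finset.card_singleton, Finset.card_univ]
    rw [Finset.prod_ite]
    simp only [Finset.prod_const, one_pow, one_mul]
    congr 1
    rw [Finset.filter_not, Finset.filter_mem_eq_inter, Finset.univ_inter,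
      ← Finset.compl_eq_univ_sdiff, Finset.card_compl]
  rw [avg_eq, h1, Fintype.card_fun]
  have hV : (Fintype.card V : ℝ≥0∞) ≠ 0 := by simp
  have hV' : (Fintype.card V : ℝ≥0∞) ≠ ∞ := by simp
  have hK := K.card_le_univ
  push_cast
  obtain ⟨m, hm⟩ := Nat.exists_eq_add_of_le hK
  rw [hm, Nat.add_sub_cancel_left, pow_add, ENNReal.mul_inv (by simp) (by simp), mul_assoc,
    ENNReal.inv_mul_cancel (by simp) (ENNReal.pow_ne_top hV'), mul_one]

theorem avg_eq_at {I V : Type} [Fintype I] [DecidableEq I] [Fintype V] [Nonempty V] (i : I)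
    (v : V) : avg (fun g : I → V => ind (v = g i)) = (Fintype.card V : ℝ≥0∞)⁻¹ := by
  rw [← pow_one (Fintype.card V : ℝ≥0∞), ← Finset.card_singleton i, ← avg_pi_eq {i} fun _ => v]
  simp [eq_comm]

end Average

/-! ## Resampling a part of the tables -/

section Resampling

variable {G : Setting}

/-- A part of the tables. -/
structure Slots (G : Setting) where
  hash : Set G.vc.Com
  alba : Set G.Seed
  cert : Set (G.Party × Fin (G.R + 1))

open Classical in
/-- The tables `t`, with the part `J` replaced by that of `t'`. -/
noncomputable def mix (J : Slots G) (t t' : Tables G) : Tables G :=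
  (fun c => if c ∈ J.hash then t'.1 c else t.1 c,
    fun x => if x.1 ∈ J.alba then t'.2.1 x else t.2.1 x,
    fun x => if x.1 ∈ J.alba then t'.2.2.1 x else t.2.2.1 x,
    fun x => if x ∈ J.cert then t'.2.2.2 x else t.2.2.2 x)

theorem mix_mix (J : Slots G) (t t' : Tables G) : mix J (mix J t t') (mix J t' t) = t := by
  obtain ⟨t1, t2, t3, t4⟩ := t
  simp only [mix, Prod.mk.injEq]
  refine ⟨?_, ?_, ?_, ?_⟩ <;> funext x <;> split_ifs <;> rfl

/-- Exchanging the parts `J` of two independent tables preserves the uniform distribution, being an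
involution on pairs. The part may depend on the table, but not on the entries that are exchanged;
this allows it to be chosen by the execution. -/
theorem avg_mix (J : Tables G → Slots G) (hJ : ∀ t t', J (mix (J t) t t') = J t)
    (g : Tables G → ℝ≥0∞) : avg g = avg fun t => avg fun t' => g (mix (J t) t t') := by
  have h1 : avg g = avg fun x : Tables G × Tables G => g x.1 := by
    rw [avg_prod (Ω := Tables G) (Ω' := Tables G)]
    simp only [avg_const]
  let e : Tables G × Tables G ≃ Tables G × Tables G :=
    { toFun := fun x => (mix (J x.1) x.1 x.2, mix (J x.1) x.2 x.1)
      invFun := fun x => (mix (J x.1) x.1 x.2, mix (J x.1) x.2 x.1)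
      left_inv := fun x => by simp only [hJ, mix_mix]
      right_inv := fun x => by simp only [hJ, mix_mix] }
  rw [h1, ← avg_equiv e, avg_prod (Ω := Tables G) (Ω' := Tables G)]
  rfl

theorem avg_tables (g : Tables G → ℝ≥0∞) : avg g = avg fun a => avg fun b => avg fun c =>
    avg fun d => g (a, b, c, d) := by
  simp only [avg_prod]

/-- If a uniformly random value decides about `E`, then two independent values satisfy `E` with at
least about the square of its probability. -/
theorem avg_le_fork (J : Slots G) (E : Tables G → Prop) {a : ℝ≥0∞} (ha : a ≠ 0) (ha' : a ≠ ∞) :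
    avg (fun t => ind (E t)) ≤
      a + a⁻¹ * avg fun t => avg fun t' => ind (E t ∧ E (mix J t t')) := by
  set h : Tables G → ℝ≥0∞ := fun t => avg fun t' => ind (E (mix J t t')) with hh
  have hmm : ∀ t t' t'', mix J (mix J t t') t'' = mix J t t'' := by
    intro t t' t''
    simp only [mix, Prod.mk.injEq]
    refine ⟨?_, ?_, ?_, ?_⟩ <;> funext x <;> split_ifs <;> rfl
  have h1 : avg (fun t => ind (E t)) = avg h := avg_mix (fun _ => J) (fun _ _ => rfl) _
  have h2 : (avg fun t => avg fun t' => ind (E t ∧ E (mix J t t'))) = avg fun t => h t * h t := by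
    have : (avg fun t => avg fun t' => ind (E t ∧ E (mix J t t'))) =
        avg fun t => ind (E t) * h t := by
      simp only [ind_and, avg_const_mul, hh]
    -- Since `h` does not depend on the part `J`, resampling that part replaces the indicator of `E`
    -- by its conditional probability `h`.
    rw [this, avg_mix (fun _ => J) (fun _ _ => rfl)]
    simp only [hh, hmm]
    simp only [avg_mul_const]
  rw [h1, h2, ← avg_const_mul]
  calc avg h ≤ avg fun t => a + a⁻¹ * (h t * h t) := by
        refine avg_mono fun t => ?_
        -- For every `x` one has `x ≤ a + x ^ 2 / a`: trivially if `x ≤ a`, and since `x / a ≥ 1`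
        -- otherwise.
        rcases le_total (h t) a with hle | hle
        · exact hle.trans le_self_add
        · refine le_trans ?_ le_add_self
          rw [← mul_assoc]
          refine le_mul_of_one_le_left' ?_
          rw [← ENNReal.inv_mul_cancel ha ha']
          exact mul_le_mul_right hle _
    _ ≤ _ := by
        rw [avg_add]
        exact add_le_add_left (avg_le_const _ fun _ => le_rfl) _

/-- `ALBA` soundness: the probability that there is a proof for a given seed with elements in a
given set. -/
theorem avg_alba_le (σ : G.vc.Setup) (s : G.Seed) (S : Finset (Ref G)) :
    avg (fun t : Tables G => ind (∃ p : AlbaProof G, (∀ j, p.2 j ∈ S) ∧ AlbaVerify ⟨σ, t⟩ s p)) ≤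
      (G.starts * S.card ^ G.D : ℕ) * ((((2 * G.f + 1 : ℕ) : ℝ≥0∞) ^ G.D)⁻¹ * (G.D : ℝ≥0∞)⁻¹) := by
  classical
  have hsingle : ∀ p : AlbaProof G, avg (fun t : Tables G => ind (AlbaVerify ⟨σ, t⟩ s p)) ≤
      (((2 * G.f + 1 : ℕ) : ℝ≥0∞) ^ G.D)⁻¹ * (G.D : ℝ≥0∞)⁻¹ := by
    intro p
    let x : Fin G.D → StepInput G := fun k =>
      (s, p.1, ⟨k, fun j => p.2 ⟨j.val, lt_of_lt_of_le j.isLt k.isLt⟩⟩)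
    -- Prefixes of different lengths are different inputs, so the `D` step values are independent.
    have hx : Function.Injective x := by
      intro k k' h
      simp only [x, Prod.mk.injEq, Sigma.mk.injEq, true_and] at h
      exact h.1
    have hv : ∀ t : Tables G, ind (AlbaVerify ⟨σ, t⟩ s p) =
        ind (∀ i ∈ Finset.univ.image x, t.2.1 i = 0) *
          ind (∀ i ∈ ({(s, p.1, p.2)} : Finset (FinalInput G)), t.2.2.1 i = ⟨0, G.D_pos⟩) := by
      intro t
      rw [← ind_and]
      congr 1
      simp only [AlbaVerify, World.albaStep, World.albaFinal, Finset.mem_image, Finset.mem_univ,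
        true_and, forall_exists_index, forall_apply_eq_imp_iff, Finset.mem_singleton,
        forall_eq, Fin.ext_iff, x, Fin.val_zero]
    have h1 := avg_pi_eq (Finset.univ.image x) fun _ => (0 : Fin (2 * G.f + 1))
    have h2 := avg_pi_eq ({(s, p.1, p.2)} : Finset (FinalInput G))
      fun _ => (⟨0, G.D_pos⟩ : Fin G.D)
    rw [Finset.card_image_of_injective _ hx, Finset.card_univ, Fintype.card_fin,
      Fintype.card_fin] at h1
    rw [Finset.card_singleton, pow_one, Fintype.card_fin] at h2
    simp only [hv]
    rw [avg_tables]
    simp only [avg_const, avg_const_mul]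
    rw [h2]
    rw [avg_mul_const, h1]
  have hu : ∀ t : Tables G,
      ind (∃ p : AlbaProof G, (∀ j, p.2 j ∈ S) ∧ AlbaVerify ⟨σ, t⟩ s p) ≤
      ∑ p ∈ (Finset.univ : Finset (Fin G.starts)) ×ˢ Fintype.piFinset fun _ : Fin G.D => S,
        ind (AlbaVerify ⟨σ, t⟩ s p) := by
    intro t
    refine le_trans (ind_mono ?_) (ind_exists_le _ _)
    rintro ⟨p, hp, hv⟩
    exact ⟨p, by simpa [Fintype.mem_piFinset] using hp, hv⟩
  refine (avg_mono hu).trans ?_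
  rw [avg_sum]
  refine (Finset.sum_le_sum fun p _ => hsingle p).trans_eq ?_
  simp

end Resampling

/-! ## Probabilities of the attacks -/

section Bounds

variable {G : Setting} {ord : HistoryOrder G} {P : Prog (Op G) (Resp G) Unit}

/-! ### Configurations under resampling. -/

theorem vcAgree_of_setup_eq {W W' : World G} (h : W.setup = W'.setup) (σ : State G) (q : Op G) :
    VCAgree W W' σ q := by
  have hr : ∀ {X : Type} (p : Prog G.vc.Query G.vc.Answer X), W.runVC p = W'.runVC p := by
    intro X p
    rw [World.runVC, World.runVC, h]
  cases q with
  | vcQuery q => simp only [VCAgree, h]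
  | advance i b => exact ⟨hr _, fun k => hr _⟩
  | deliver i k r => exact fun v _ t => hr _
  | _ => trivial

/-- The commitment is determined before any value of a hash function is read, so agreement of those
is not needed. -/
theorem Config.com_eq {W W' : World G} (h : W.setup = W'.setup) {x : Config G}
    (hc : CertsAgree W W' x.2.fixed) (hx : Covered x.2) : x.com W = x.com W' := by
  obtain ⟨p, σ⟩ := x
  cases p with
  | ret x => rfl
  | ask q next =>
    cases q with
    | advance i b =>
      have : vecOf W σ i = vecOf W' σ i := by
        unfold vecOf
        rw [(hc.of_subset (hx.dag i)).certAt]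
      simp only [Config.com, comOf, this, World.runVC, h]
    | _ => rfl

theorem Config.Agree.seed_eq {W W' : World G} {x : Config G} (h : x.Agree W W')
    (hx : Covered x.2) : x.seed W = x.seed W' := by
  obtain ⟨p, σ⟩ := x
  cases p with
  | ret x => rfl
  | ask q next =>
    have h1 := Agree.comOf_eq h hx
    have h2 : (comOf W σ q).map W.hash = (comOf W' σ q).map W'.hash := by
      rw [← h1]
      cases hc : comOf W σ q with
      | none => rfl
      | some c => simp [Agree.hash h c hc]
    cases q with
    | advance i b => exact h2
    | deliver i k r => exact h2
    | _ => rfl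

theorem cert_mix {σ : G.vc.Setup} {J : Slots G} {τ τ' : Tables G} {k : G.Party} {r : ℕ}
    (h : ∀ x ∈ J.cert, (x.1, x.2.val) ≠ (k, r)) :
    World.cert ⟨σ, mix J τ τ'⟩ k r = World.cert ⟨σ, τ⟩ k r := by
  unfold World.cert
  split_ifs with hr
  · have : (k, (⟨r, hr⟩ : Fin (G.R + 1))) ∉ J.cert := fun hx => h _ hx rfl
    simp [mix, this]
  · rfl

theorem certsAgree_mix {σ : G.vc.Setup} {J : Slots G} {τ τ' : Tables G} {d : Dag G}
    (h : ∀ x ∈ J.cert, x.2.val ≠ 0 ∧ d (x.2.val, x.1) = none) :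
    CertsAgree ⟨σ, τ⟩ ⟨σ, mix J τ τ'⟩ d := by
  intro r k hrk
  refine (cert_mix fun x hx hxe => ?_).symm
  simp only [Prod.mk.injEq] at hxe
  have := h x hx
  rw [hxe.1, hxe.2] at this
  exact hrk.elim this.1 fun h => h this.2

theorem nonVoterRefs_congr {W W' : World G} (h : ∀ k r, W.cert k r = W'.cert k r) (F : Dag G)
    (r : ℕ) : nonVoterRefs W F r = nonVoterRefs W' F r := by
  have : W.cert = W'.cert := funext₂ h
  unfold nonVoterRefs nonVoters anchorOf
  rw [this]

theorem hash_mix {σ : G.vc.Setup} {J : Slots G} {τ τ' : Tables G} {c : G.vc.Com}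
    (h : c ∉ J.hash) : World.hash ⟨σ, mix J τ τ'⟩ c = World.hash ⟨σ, τ⟩ c := by
  simp [World.hash, mix, h]

theorem albaAgree_mix {σ : G.vc.Setup} {J : Slots G} {τ τ' : Tables G} {s : G.Seed}
    (h : s ∉ J.alba) : AlbaAgree ⟨σ, τ⟩ ⟨σ, mix J τ τ'⟩ s := by
  constructor <;> rintro x rfl <;> simp [World.albaStep, World.albaFinal, mix, h]

theorem albaAgree_mix_of_mem {σ : G.vc.Setup} {J : Slots G} {τ τ' : Tables G} {s : G.Seed}
    (h : s ∈ J.alba) : AlbaAgree ⟨σ, mix J τ τ'⟩ ⟨σ, τ'⟩ s := by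
  constructor <;> rintro x rfl <;> simp [World.albaStep, World.albaFinal, mix, h]

/-- An action that avoids the resampled slots cannot notice the change. Genesis certificates are
public from the start, hence the exclusion of round `0`. -/
theorem Config.agree_mix {σ : G.vc.Setup} {J : Slots G} {τ τ' : Tables G} {x : Config G}
    (h1 : ∀ c ∈ J.hash, x.com ⟨σ, τ⟩ ≠ some c) (h2 : ∀ s ∈ J.alba, x.seed ⟨σ, τ⟩ ≠ some s)
    (h3 : ∀ y ∈ J.cert, y.2.val ≠ 0 ∧ x.2.fixed (y.2.val, y.1) = none) :
    x.Agree ⟨σ, τ⟩ ⟨σ, mix J τ τ'⟩ := by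
  obtain ⟨p, S⟩ := x
  cases p with
  | ret x => trivial
  | ask q next =>
    exact ⟨certsAgree_mix h3, fun c hc => (hash_mix fun hJ => h1 c hJ hc).symm,
      fun s hs => albaAgree_mix fun hJ => h2 s hJ hs, vcAgree_of_setup_eq rfl _ _⟩

/-! ### Bounds for the three attacks. -/

/-- Resample `Hash` at the commitment that is first hashed in step `t`. Neither this commitment nor
the at most `t` seeds used before depend on the new value, which hits each of them with probability
`2 ^ (-lam)`. -/
theorem avg_seedReused_le (σ : G.vc.Setup) (t : ℕ) :
    avg (fun τ : Tables G => ind (SeedReused ord P ⟨σ, τ⟩ t)) ≤ t * ((2 : ℝ≥0∞) ^ G.lam)⁻¹ := by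
  classical
  let J : Tables G → Slots G := fun τ => ⟨{c | FirstCom ord P ⟨σ, τ⟩ t c}, ∅, ∅⟩
  have hagree : ∀ τ τ', ∀ u < t,
      (conf ord P ⟨σ, τ⟩ u).Agree ⟨σ, τ⟩ ⟨σ, mix (J τ) τ τ'⟩ := fun τ τ' u hu =>
    Config.agree_mix (fun c hc => hc.2 u hu) (fun s hs => hs.elim) (fun y hy => hy.elim)
  have hconf : ∀ τ τ', ∀ u ≤ t,
      conf ord P ⟨σ, mix (J τ) τ τ'⟩ u = conf ord P ⟨σ, τ⟩ u := fun τ τ' u hu =>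
    (conf_eq_of_agree fun v hv => hagree τ τ' v (by omega)).symm
  have hcom : ∀ τ τ', ∀ u ≤ t, (conf ord P ⟨σ, τ⟩ u).com ⟨σ, mix (J τ) τ τ'⟩ =
      (conf ord P ⟨σ, τ⟩ u).com ⟨σ, τ⟩ := fun τ τ' u hu =>
    (Config.com_eq (W := ⟨σ, τ⟩) (W' := ⟨σ, mix (J τ) τ τ'⟩) rfl
      (certsAgree_mix fun y hy => hy.elim) (covered_conf u)).symm
  have hfirst : ∀ τ τ' c, FirstCom ord P ⟨σ, mix (J τ) τ τ'⟩ t c ↔ FirstCom ord P ⟨σ, τ⟩ t c := by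
    intro τ τ' c
    unfold FirstCom
    rw [hconf τ τ' t le_rfl, hcom τ τ' t le_rfl]
    refine and_congr_right fun _ => forall₂_congr fun u hu => ?_
    rw [hconf τ τ' u hu.le, hcom τ τ' u hu.le]
  rw [avg_mix J fun τ τ' => by simp only [J, hfirst]]
  refine avg_le_const _ fun τ => ?_
  by_cases hex : ∃ c, FirstCom ord P ⟨σ, τ⟩ t c
  · obtain ⟨c, hc⟩ := hex
    have hle : ∀ τ', ind (SeedReused ord P ⟨σ, mix (J τ) τ τ'⟩ t) ≤ ∑ u ∈ Finset.range t,
        ind ((conf ord P ⟨σ, τ⟩ u).seed ⟨σ, τ⟩ = some (τ'.1 c)) := by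
      intro τ'
      refine le_trans (ind_mono ?_) (ind_exists_le _ _)
      rintro ⟨c', hc', u, hu, hs⟩
      rw [hfirst] at hc'
      obtain rfl : c = c' := Option.some.inj (hc.1.symm.trans hc'.1)
      refine ⟨u, by simpa using hu, ?_⟩
      rw [(hagree τ τ' u hu).seed_eq (covered_conf u), ← hconf τ τ' u hu.le, hs]
      simp [World.hash, mix, J, hc]
    refine (avg_mono hle).trans ?_
    rw [avg_sum]
    refine (Finset.sum_le_card_nsmul _ _ ((2 : ℝ≥0∞) ^ G.lam)⁻¹ fun u _ => ?_).trans_eq (by simp)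
    cases (conf ord P ⟨σ, τ⟩ u).seed ⟨σ, τ⟩ with
    | none => simp [ind, avg_const]
    | some s =>
      rw [avg_tables]
      simp only [avg_const, Option.some.injEq]
      rw [avg_eq_at]
      simp
  · have : ∀ τ', ind (SeedReused ord P ⟨σ, mix (J τ) τ τ'⟩ t) = 0 := by
      intro τ'
      rw [ind, if_neg]
      rintro ⟨c, hc, -⟩
      exact hex ⟨c, (hfirst τ τ' c).1 hc⟩
    simp only [this]
    rw [avg_const]
    exact zero_le

/-- Resample the ALBA functions at the fresh seed. The execution up to step `t`, the seed and the
set of non-voters stay the same, so soundness applies to a fixed set of at most `f` references. -/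
theorem avg_sampleEscapes_le (σ : G.vc.Setup) (t r : ℕ) :
    avg (fun τ : Tables G => ind (SampleEscapes ord P ⟨σ, τ⟩ t r)) ≤
      (G.starts * G.f ^ G.D : ℕ) *
        ((((2 * G.f + 1 : ℕ) : ℝ≥0∞) ^ G.D)⁻¹ * (G.D : ℝ≥0∞)⁻¹) := by
  classical
  let J : Tables G → Slots G := fun τ => ⟨∅, {s | FreshSeed ord P ⟨σ, τ⟩ t s}, ∅⟩
  have hagree : ∀ τ τ', ∀ u < t,
      (conf ord P ⟨σ, τ⟩ u).Agree ⟨σ, τ⟩ ⟨σ, mix (J τ) τ τ'⟩ := fun τ τ' u hu =>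
    Config.agree_mix (fun s hs => hs.elim) (fun s hs => hs.2 u hu) (fun y hy => hy.elim)
  have hconf : ∀ τ τ', ∀ u ≤ t,
      conf ord P ⟨σ, mix (J τ) τ τ'⟩ u = conf ord P ⟨σ, τ⟩ u := fun τ τ' u hu =>
    (conf_eq_of_agree fun v hv => hagree τ τ' v (by omega)).symm
  have hcom : ∀ τ τ', (conf ord P ⟨σ, τ⟩ t).com ⟨σ, mix (J τ) τ τ'⟩ =
      (conf ord P ⟨σ, τ⟩ t).com ⟨σ, τ⟩ := fun τ τ' =>
    (Config.com_eq (W := ⟨σ, τ⟩) (W' := ⟨σ, mix (J τ) τ τ'⟩) rfl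
      (certsAgree_mix fun y hy => hy.elim) (covered_conf t)).symm
  have hfresh : ∀ τ τ' s,
      FreshSeed ord P ⟨σ, mix (J τ) τ τ'⟩ t s ↔ FreshSeed ord P ⟨σ, τ⟩ t s := by
    intro τ τ' s
    unfold FreshSeed
    rw [hconf τ τ' t le_rfl, hcom τ τ']
    refine and_congr (exists_congr fun c => ?_) (forall₂_congr fun u hu => ?_)
    · rw [hash_mix (by simp [J])]
    · rw [hconf τ τ' u hu.le, (hagree τ τ' u hu).seed_eq (covered_conf u)]
  have hrefs : ∀ τ τ' F, nonVoterRefs ⟨σ, mix (J τ) τ τ'⟩ F r = nonVoterRefs ⟨σ, τ⟩ F r :=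
    fun τ τ' F => nonVoterRefs_congr (fun k r => cert_mix (by simp [J])) F r
  rw [avg_mix J fun τ τ' => by simp only [J, hfresh]]
  refine avg_le_const _ fun τ => ?_
  by_cases hex : ∃ s, FreshSeed ord P ⟨σ, τ⟩ t s ∧
      (nonVoterRefs ⟨σ, τ⟩ (conf ord P ⟨σ, τ⟩ t).2.fixed r).card ≤ G.f
  · obtain ⟨s, hs, hcard⟩ := hex
    have hle : ∀ τ', ind (SampleEscapes ord P ⟨σ, mix (J τ) τ τ'⟩ t r) ≤
        ind (∃ p : AlbaProof G,
          (∀ j, p.2 j ∈ nonVoterRefs ⟨σ, τ⟩ (conf ord P ⟨σ, τ⟩ t).2.fixed r) ∧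
            AlbaVerify ⟨σ, τ'⟩ s p) := by
      intro τ'
      refine ind_mono ?_
      rintro ⟨s', hs', -, p, hp, hv⟩
      rw [hfresh] at hs'
      obtain ⟨⟨c, hc, rfl⟩, -⟩ := hs
      obtain ⟨⟨c', hc', rfl⟩, hs'⟩ := hs'
      obtain rfl : c = c' := Option.some.inj (hc.symm.trans hc')
      refine ⟨p, fun j => ?_, ?_⟩
      · have := hp j
        rwa [hconf τ τ' t le_rfl, hrefs] at this
      · rwa [(albaAgree_mix_of_mem (show World.hash ⟨σ, τ⟩ c ∈ (J τ).alba from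
          ⟨⟨c, hc, rfl⟩, hs'⟩)).albaVerify] at hv
    refine (avg_mono hle).trans ((avg_alba_le σ s _).trans ?_)
    gcongr
  · have : ∀ τ', ind (SampleEscapes ord P ⟨σ, mix (J τ) τ τ'⟩ t r) = 0 := by
      intro τ'
      rw [ind, if_neg]
      rintro ⟨s, hs, hcard, -⟩
      refine hex ⟨s, (hfresh τ τ' s).1 hs, ?_⟩
      rwa [hconf τ τ' t le_rfl, hrefs] at hcard
    simp only [this]
    rw [avg_const]
    exact zero_le

/-- The certificate of the vertex of `k` in round `r`. -/
def certSlot (G : Setting) (k : G.Party) (r : Fin (G.R + 1)) : Slots G := ⟨∅, ∅, {(k, r)}⟩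

/-- Two executions that differ in the certificate of the vertex of `k` in round `r` lead to
accepted openings of one commitment to both certificates. -/
def DoubleOpens (ord : HistoryOrder G) (P : Prog (Op G) (Resp G) Unit) (W W' : World G) (T : ℕ)
    (r : ℕ) (k k' : G.Party) (j : Fin G.D) : Prop :=
  ∃ w w', (conf ord P W T).2.fixed (r + 1, k') = some w ∧
    (conf ord P W' T).2.fixed (r + 1, k') = some w' ∧ w.com = w'.com ∧
    W.cert k r ≠ W'.cert k r ∧
    W.runVC (G.vc.verify w.com k (some (W.cert k r)) (w.openings j)) = true ∧
    W'.runVC (G.vc.verify w'.com k (some (W'.cert k r)) (w'.openings j)) = true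

/-- Fork at the certificate of `(k, r)`. It cannot be read before its vertex is fixed, so both
executions coincide up to step `t` and hash the same commitment there, even if they diverge later.
The term `2 ^ (-lam)` accounts for equal certificates. -/
theorem avg_prematureOpening_le (σ : G.vc.Setup) (T t : ℕ) (r : Fin (G.R + 1))
    (hr : 1 ≤ r.val) (k k' : G.Party) (j : Fin G.D) {a : ℝ≥0∞} (ha : a ≠ 0) (ha' : a ≠ ∞) :
    avg (fun τ : Tables G => ind (PrematureOpening ord P ⟨σ, τ⟩ T t r k k' j)) ≤
      a + a⁻¹ * (avg (fun τ => avg fun τ' =>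
        ind (DoubleOpens ord P ⟨σ, τ⟩ ⟨σ, mix (certSlot G k r) τ τ'⟩ T r k k' j)) +
          ((2 : ℝ≥0∞) ^ G.lam)⁻¹) := by
  classical
  refine (avg_le_fork (certSlot G k r) _ ha ha').trans ?_
  gcongr
  calc _ ≤ avg fun τ : Tables G => avg fun τ' =>
        ind (DoubleOpens ord P ⟨σ, τ⟩ ⟨σ, mix (certSlot G k r) τ τ'⟩ T r k k' j) +
          ind (τ.2.2.2 (k, r) = τ'.2.2.2 (k, r)) := by
        refine avg_mono fun τ => avg_mono fun τ' => ?_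
        refine le_trans (ind_mono ?_) (ind_or_le _ _)
        rintro ⟨⟨w, h1, h2, h3, h4, h5⟩, w', h1', h2', h3', h4', h5'⟩
        refine or_iff_not_imp_right.2 fun hne => ?_
        -- Fixing is permanent, so an instance open at step `t` was open at every earlier step.
        have hnone : ∀ u ≤ t, (conf ord P ⟨σ, τ⟩ u).2.fixed (r.val, k) = none := by
          intro u hu
          by_contra hn
          obtain ⟨v, hv⟩ := Option.ne_none_iff_exists'.1 hn
          rw [conf_fixed_mono hu hv] at h3
          cases h3
        have hslot : ∀ u ≤ t, ∀ y ∈ (certSlot G k r).cert,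
            y.2.val ≠ 0 ∧ (conf ord P ⟨σ, τ⟩ u).2.fixed (y.2.val, y.1) = none := by
          rintro u hu y hy
          obtain rfl : y = (k, r) := hy
          exact ⟨show r.val ≠ 0 by omega, hnone u hu⟩
        have hconf : conf ord P ⟨σ, τ⟩ t = conf ord P ⟨σ, mix (certSlot G k r) τ τ'⟩ t :=
          conf_eq_of_agree fun u hu => Config.agree_mix (fun c hc => hc.elim)
            (fun s hs => hs.elim) (hslot u hu.le)
        refine ⟨w, w', h1, h1', ?_, ?_, h5, h5'⟩
        · have hcom : (conf ord P ⟨σ, τ⟩ t).com ⟨σ, τ⟩ =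
              (conf ord P ⟨σ, τ⟩ t).com ⟨σ, mix (certSlot G k r) τ τ'⟩ :=
            Config.com_eq (W := ⟨σ, τ⟩) (W' := ⟨σ, mix (certSlot G k r) τ τ'⟩) rfl
              (certsAgree_mix (hslot t le_rfl)) (covered_conf t)
          rw [← hconf, ← hcom, h2] at h2'
          exact Option.some.inj h2'
        · simpa [World.cert, mix, certSlot, Nat.lt_succ_iff.1 r.isLt] using hne
    _ = _ := by
        simp only [avg_add]
        congr 1
        have : ∀ τ : Tables G, avg (fun τ' : Tables G =>
            ind (τ.2.2.2 (k, r) = τ'.2.2.2 (k, r))) = ((2 : ℝ≥0∞) ^ G.lam)⁻¹ := by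
          intro τ
          rw [avg_tables]
          simp only [avg_const]
          rw [avg_eq_at]
          simp
        simp only [this, avg_const]

end Bounds

/-! ## The attacker on position binding -/

section Attacker

namespace Prog

variable {Q A X Y : Type}

/-- Run a program, and then another one that depends on its result. -/
def bind : Prog Q A X → (X → Prog Q A Y) → Prog Q A Y
  | .ret x, f => f x
  | .ask q next, f => .ask q fun a => (next a).bind f

theorem eval_bind (o : Q → A) (p : Prog Q A X) (f : X → Prog Q A Y) :
    (p.bind f).eval o = (f (p.eval o)).eval o := by
  induction p with
  | ret x => rfl
  | ask q next ih => exact ih _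

theorem Bounded.mono {p : Prog Q A X} {t u : ℕ} (h : p.Bounded t) (htu : t ≤ u) :
    p.Bounded u := by
  induction p generalizing t u with
  | ret x => trivial
  | ask q next ih =>
    cases t with
    | zero => exact h.elim
    | succ t =>
      obtain ⟨u, rfl⟩ : ∃ v, u = v + 1 := ⟨u - 1, by omega⟩
      exact fun a => ih a (h a) (by omega)

theorem Bounded.bind {p : Prog Q A X} {f : X → Prog Q A Y} {t u : ℕ} (h : p.Bounded t)
    (hf : ∀ x, (f x).Bounded u) : (p.bind f).Bounded (t + u) := by
  induction p generalizing t with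
  | ret x => exact (hf x).mono (by omega)
  | ask q next ih =>
    cases t with
    | zero => exact h.elim
    | succ t =>
      rw [Nat.add_right_comm]
      exact fun a => ih a (h a)

end Prog

/-- A function of the setup that can be computed with at most `b` oracle queries. -/
def Computable {n : ℕ} {V : Type} (vc : VectorCommitment n V) {X : Type} (g : vc.Setup → X)
    (b : ℕ) : Prop :=
  ∃ p : Prog vc.Query vc.Answer X, p.Bounded b ∧ ∀ s, p.eval (vc.oracle s) = g s

namespace Computable

variable {n : ℕ} {V X Y : Type} {vc : VectorCommitment n V} {b b' : ℕ}

theorem const (x : X) : Computable vc (fun _ => x) b := ⟨.ret x, trivial, fun _ => rfl⟩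

theorem mono {g : vc.Setup → X} (h : Computable vc g b) (hb : b ≤ b') : Computable vc g b' :=
  let ⟨p, hp, he⟩ := h
  ⟨p, hp.mono hb, he⟩

/-- Continuations matter only for values that `g` attains; elsewhere a program without requests is
substituted. -/
theorem bind {g : vc.Setup → X} (hg : Computable vc g b) {h : X → vc.Setup → Y}
    (hh : ∀ s, Computable vc (h (g s)) b') : Computable vc (fun s => h (g s) s) (b + b') := by
  classical
  obtain ⟨p, hp, he⟩ := hg
  obtain ⟨s₀, -⟩ := vc.law.support_nonempty
  have : ∀ x, ∃ q : Prog vc.Query vc.Answer Y, q.Bounded b' ∧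
      ∀ s, g s = x → q.eval (vc.oracle s) = h x s := by
    intro x
    by_cases hx : ∃ s, g s = x
    · obtain ⟨s, rfl⟩ := hx
      obtain ⟨q, hq, hqe⟩ := hh s
      exact ⟨q, hq, fun s _ => hqe s⟩
    · exact ⟨.ret (h x s₀), trivial, fun s hs => (hx ⟨s, hs⟩).elim⟩
  choose q hq hqe using this
  exact ⟨p.bind q, hp.bind hq, fun s => by rw [Prog.eval_bind, he, hqe _ s rfl]⟩

theorem map {g : vc.Setup → X} (hg : Computable vc g b) (F : X → Y) :
    Computable vc (fun s => F (g s)) b :=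
  bind (b' := 0) hg (h := fun x _ => F x) fun _ => const _

/-- Local computation is free, so whatever is determined by a computable value is computable at the
same cost. -/
theorem of_factor {g : vc.Setup → X} (hg : Computable vc g b) {h : vc.Setup → Y}
    (hgh : ∀ s s', g s = g s' → h s = h s') : Computable vc h b := by
  have hne : Nonempty vc.Setup := ⟨vc.law.support_nonempty.some⟩
  have := hg.map fun x => h (Function.invFun g x)
  convert this using 2 with s
  exact hgh _ _ (Function.invFun_eq ⟨s, rfl⟩).symm

theorem prod {g : vc.Setup → X} (hg : Computable vc g b) {h : vc.Setup → Y}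
    (hh : Computable vc h b') : Computable vc (fun s => (g s, h s)) (b + b') :=
  bind hg (h := fun x s => (x, h s)) fun s => hh.map (Prod.mk (g s))

theorem pi {m : ℕ} {g : Fin m → vc.Setup → X} (hg : ∀ i, Computable vc (g i) b) :
    Computable vc (fun s i => g i s) (m * b) := by
  induction m with
  | zero =>
    have := const (vc := vc) (b := 0 * b) (fun i : Fin 0 => i.elim0 : Fin 0 → X)
    convert this using 3 with s i
  | succ m ih =>
    have := ((ih fun i => hg i.castSucc).prod (hg (Fin.last m))).map
      fun x => (Fin.snoc x.1 x.2 : Fin (m + 1) → X)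
    rw [Nat.succ_mul]
    convert this using 2 with s
    ext i
    refine Fin.lastCases ?_ (fun i => ?_) i <;> simp

end Computable

variable {G : Setting} {ord : HistoryOrder G}

/-- The number of queries of each operation of the vector commitment scheme is at most `b`. -/
def OpsBounded {n : ℕ} {V : Type} (vc : VectorCommitment n V) (b : ℕ) : Prop :=
  (∀ a, (vc.commit a).Bounded b) ∧ (∀ a i, (vc.prove a i).Bounded b) ∧
    ∀ c i x o, (vc.verify c i x o).Bounded b

theorem certsAgree_setup (τ : Tables G) (s s' : G.vc.Setup) (d : Dag G) :
    CertsAgree ⟨s, τ⟩ ⟨s', τ⟩ d := fun _ _ _ => rfl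

/-- For fixed tables a step depends on the setup only through the answers in `VCAgree`. It suffices
to ask for one oracle answer, or one commitment with the opening proofs of all `n` positions
(whatever ALBA samples), or `D` verifications; the bound covers each case. -/
theorem computable_step {b : ℕ} (hb : OpsBounded G.vc b) (τ : Tables G) {σ : State G}
    (hσ : Covered σ) (q : Op G) : Computable G.vc (fun s => σ.step ⟨s, τ⟩ ord q)
      (1 + (G.n + G.D + 1) * b) := by
  obtain ⟨s₀, -⟩ := G.vc.law.support_nonempty
  have key : ∀ s s', VCAgree ⟨s, τ⟩ ⟨s', τ⟩ σ q → σ.step ⟨s, τ⟩ ord q = σ.step ⟨s', τ⟩ ord q :=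
    fun s s' h => Agree.step_eq ⟨certsAgree_setup τ s s' _, fun _ _ => rfl,
      fun _ _ => ⟨fun _ _ => rfl, fun _ _ => rfl⟩, h⟩ hσ ord
  cases q with
  | vcQuery q =>
    have h1 : Computable G.vc (fun s => G.vc.oracle s q) (1 + (G.n + G.D + 1) * b) :=
      ⟨.ask q .ret, Prog.Bounded.mono (t := 1) (fun _ => trivial) (Nat.le_add_right _ _),
        fun s => rfl⟩
    exact h1.of_factor fun s s' h => key s s' h
  | advance i bl =>
    have h1 : Computable G.vc (fun s => World.runVC ⟨s, τ⟩ (G.vc.commit (vecOf ⟨s₀, τ⟩ σ i))) b :=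
      ⟨_, hb.1 _, fun s => rfl⟩
    have h2 : Computable G.vc
        (fun s k => World.runVC ⟨s, τ⟩ (G.vc.prove (vecOf ⟨s₀, τ⟩ σ i) k)) (G.n * b) :=
      Computable.pi fun k => ⟨_, hb.2.1 _ _, fun s => rfl⟩
    refine ((h1.prod h2).of_factor fun s s' h => key s s' ?_).mono (by nlinarith)
    have hv : vecOf ⟨s, τ⟩ σ i = vecOf ⟨s₀, τ⟩ σ i := by
      unfold vecOf
      rw [(certsAgree_setup τ s s₀ _).certAt]
    simp only [Prod.mk.injEq] at h
    simp only [VCAgree, hv]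
    exact ⟨h.1, fun k => congrFun h.2 k⟩
  | deliver i k r =>
    cases hf : σ.fixed (r, k) with
    | none =>
      refine (Computable.const ()).of_factor (fun s s' _ => key s s' ?_)
      intro v hv
      rw [hf] at hv
      cases hv
    | some v =>
      have h1 : Computable G.vc (fun s t => World.runVC ⟨s, τ⟩ (G.vc.verify v.com (v.sample t).1
          (some (v.sample t).2) (v.openings t))) (G.D * b) :=
        Computable.pi fun t => ⟨_, hb.2.2 _ _ _ _, fun s => rfl⟩
      refine (h1.of_factor fun s s' h => key s s' ?_).mono (by nlinarith)
      intro v' hv t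
      rw [hf] at hv
      cases hv
      exact congrFun h t
  | _ => exact (Computable.const ()).of_factor fun s s' _ => key s s' trivial

theorem computable_run {b : ℕ} (hb : OpsBounded G.vc b) (τ : Tables G) {σ : State G}
    (hσ : Covered σ) {P : Prog (Op G) (Resp G) Unit} {T : ℕ} (hP : P.Bounded T) :
    Computable G.vc (fun s => State.run ⟨s, τ⟩ ord σ P) (T * (1 + (G.n + G.D + 1) * b)) := by
  induction T generalizing P σ with
  | zero =>
    cases P with
    | ret x => exact Computable.const _
    | ask q next => exact hP.elim
  | succ T ih =>
    cases P with
    | ret x => exact Computable.const _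
    | ask q next =>
      exact ((computable_step hb τ hσ q).bind
        (h := fun x s => State.run ⟨s, τ⟩ ord x.1 (next x.2))
        fun s => ih (hσ.step _ _) (hP _)).mono
        ((Nat.add_comm _ _).trans (Nat.succ_mul _ _).symm).le

/-- The double opening extracted from two executions. -/
def extract (τ τ' : Tables G) (r : ℕ) (k k' : G.Party) (j : Fin G.D) (σ σ' : State G) :
    G.vc.Setup → Option (VectorCommitment.DoubleOpening G.vc) := fun s =>
  match σ.fixed (r + 1, k'), σ'.fixed (r + 1, k') with
  | some w, some w' => some
    { com := w.com
      pos := k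
      value₁ := some (World.cert ⟨s, τ⟩ k r)
      opening₁ := w.openings j
      value₂ := some (World.cert ⟨s, τ'⟩ k r)
      opening₂ := w'.openings j }
  | _, _ => none

/-- The attacker draws the tables itself as part of its coins and simulates both executions, so its
only queries are those to the commitment oracle. This oracle is static and can serve both; hence the
factor `2`. -/
theorem exists_attacker {b T : ℕ} (hb : OpsBounded G.vc b) (A : Adversary G)
    (hA : ∀ c, (A.prog c).Bounded T) (r : Fin (G.R + 1)) (k k' : G.Party) (j : Fin G.D) :
    ∃ B : VectorCommitment.Attacker G.vc,
      (∀ c, (B.prog c).Bounded (2 * (T * (1 + (G.n + G.D + 1) * b)))) ∧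
      ∑' s, G.vc.law s * ∑' c, A.law c * avg (fun τ => avg fun τ' => ind
        (DoubleOpens ord (A.prog c) ⟨s, τ⟩ ⟨s, mix (certSlot G k r) τ τ'⟩ T r k k' j)) ≤
        B.advantage := by
  classical
  let out : A.Coin × Tables G × Tables G → G.vc.Setup →
      Option (VectorCommitment.DoubleOpening G.vc) := fun c s =>
    extract c.2.1 (mix (certSlot G k r) c.2.1 c.2.2) r k k' j
      (State.run ⟨s, c.2.1⟩ ord (State.init G) (A.prog c.1))
      (State.run ⟨s, mix (certSlot G k r) c.2.1 c.2.2⟩ ord (State.init G) (A.prog c.1)) s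
  have hcomp : ∀ c, Computable G.vc (out c) (2 * (T * (1 + (G.n + G.D + 1) * b))) := by
    intro c
    obtain ⟨s₀, -⟩ := G.vc.law.support_nonempty
    have h1 := ((computable_run (ord := ord) hb c.2.1 Covered.init (hA c.1)).prod
      (computable_run (ord := ord) hb (mix (certSlot G k r) c.2.1 c.2.2) Covered.init (hA c.1))).map
        -- Certificates do not involve the setup, so an arbitrary `s₀` may replace the actual one.
        fun x => extract c.2.1 (mix (certSlot G k r) c.2.1 c.2.2) r k k' j x.1 x.2 s₀
    rw [two_mul]
    exact h1
  choose prog hprog heval using hcomp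
  refine ⟨⟨A.Coin × Tables G × Tables G, A.law.bind fun c =>
    (PMF.uniformOfFintype (Tables G × Tables G)).map (Prod.mk c), prog⟩, hprog, ?_⟩
  simp only [VectorCommitment.Attacker.advantage, PMF.toOuterMeasure_bind_apply,
    PMF.toOuterMeasure_map_apply]
  refine ENNReal.tsum_le_tsum fun s => mul_le_mul_right (ENNReal.tsum_le_tsum fun c =>
    mul_le_mul_right ?_ _) _
  have hprod := avg_prod (Ω := Tables G) (Ω' := Tables G) fun x => ind
    (DoubleOpens ord (A.prog c) ⟨s, x.1⟩ ⟨s, mix (certSlot G k r) x.1 x.2⟩ T r k k' j)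
  simp only at hprod
  rw [← hprod, ← uniform_toOuterMeasure]
  refine MeasureTheory.OuterMeasure.mono _ ?_
  rintro ⟨τ, τ'⟩ ⟨w, w', h1, h2, h3, h4, h5, h6⟩
  rw [← run_eq_conf (hA c)] at h1 h2
  refine ⟨⟨w.com, k, some (World.cert ⟨s, τ⟩ k r), w.openings j,
    some (World.cert ⟨s, mix (certSlot G k r) τ τ'⟩ k r), w'.openings j⟩, ?_,
    fun h => h4 (Option.some.inj h), h5, by rw [h3]; exact h6⟩
  rw [heval]
  simp only at h1 h2
  simp only [out, extract, h1, h2]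

end Attacker

/-! ## Asymptotics -/

section Asymptotics

open Filter

namespace PolyBounded

theorem mono {S T : ℕ → ℕ} (hT : PolyBounded T) (h : ∀ k, S k ≤ T k) : PolyBounded S :=
  let ⟨p, hp⟩ := hT
  ⟨p, fun k => (h k).trans (hp k)⟩

theorem const (n : ℕ) : PolyBounded fun _ => n := ⟨Polynomial.C n, by simp⟩

theorem id : PolyBounded fun k => k := ⟨Polynomial.X, by simp⟩

theorem add {S T : ℕ → ℕ} (hS : PolyBounded S) (hT : PolyBounded T) :
    PolyBounded fun k => S k + T k :=
  let ⟨p, hp⟩ := hS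
  let ⟨q, hq⟩ := hT
  ⟨p + q, fun k => by simpa using add_le_add (hp k) (hq k)⟩

theorem mul {S T : ℕ → ℕ} (hS : PolyBounded S) (hT : PolyBounded T) :
    PolyBounded fun k => S k * T k :=
  let ⟨p, hp⟩ := hS
  let ⟨q, hq⟩ := hT
  ⟨p * q, fun k => by simpa using Nat.mul_le_mul (hp k) (hq k)⟩

theorem of_eventually {S T : ℕ → ℕ} (hT : PolyBounded T) (h : ∀ᶠ k in atTop, S k ≤ T k) :
    PolyBounded S := by
  obtain ⟨N, hN⟩ := eventually_atTop.1 h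
  -- The constant dominates the finitely many exceptional values.
  refine ((const (∑ i ∈ Finset.range N, S i)).add hT).mono fun k => ?_
  rcases lt_or_ge k N with hk | hk
  · exact (Finset.single_le_sum (f := S) (fun _ _ => Nat.zero_le _)
      (Finset.mem_range.2 hk)).trans (Nat.le_add_right _ _)
  · exact (hN k hk).trans (Nat.le_add_left _ _)

theorem of_isBigO {S : ℕ → ℕ} (h : (fun k => (S k : ℝ)) =O[atTop] fun k : ℕ => (k : ℝ)) :
    PolyBounded S := by
  obtain ⟨C, hC⟩ := h.bound
  refine ((const ⌈C⌉₊).mul id).of_eventually (hC.mono fun k hk => ?_)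
  simp only [Real.norm_natCast] at hk
  have : C * k ≤ (⌈C⌉₊ * k : ℕ) := by
    push_cast
    exact mul_le_mul_of_nonneg_right (Nat.le_ceil C) (Nat.cast_nonneg k)
  exact_mod_cast hk.trans this

theorem eventually_le_rpow {T : ℕ → ℕ} (hT : PolyBounded T) {c : ℝ} (hc : 0 < c) :
    ∀ᶠ k : ℕ in atTop, (T k : ℝ) ≤ 2 ^ (c * (k : ℝ)) := by
  obtain ⟨p, hp⟩ := hT
  have hb : 0 < Real.log 2 * c := mul_pos (Real.log_pos one_lt_two) hc
  set b := Real.log 2 * c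
  -- As `2 ^ (c k) = exp (b k)`, the polynomial is rescaled so that `q (b k) = p k`.
  let q : Polynomial ℝ := (p.map (Nat.castRingHom ℝ)).comp (Polynomial.C b⁻¹ * Polynomial.X)
  have h1 : Tendsto (fun k : ℕ => b * (k : ℝ)) atTop atTop :=
    tendsto_natCast_atTop_atTop.const_mul_atTop hb
  have h2 := (q.tendsto_div_exp_atTop.comp h1).eventually (ge_mem_nhds one_pos)
  refine h2.mono fun k hk => ?_
  have h3 : q.eval (b * (k : ℝ)) = (p.eval k : ℕ) := by
    simp only [q, Polynomial.eval_comp, Polynomial.eval_mul, Polynomial.eval_C, Polynomial.eval_X]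
    rw [inv_mul_cancel_left₀ hb.ne', Polynomial.eval_natCast_map]
    simp
  simp only [Function.comp_apply, h3] at hk
  rw [div_le_one (Real.exp_pos _)] at hk
  rw [Real.rpow_def_of_pos two_pos, ← mul_assoc]
  exact le_trans (by exact_mod_cast hp k) hk

end PolyBounded

namespace ExpSmall

theorem mono {ε δ : ℕ → ℝ≥0∞} (hδ : ExpSmall δ) (h : ∀ᶠ k in atTop, ε k ≤ δ k) : ExpSmall ε :=
  let ⟨c, hc, hδ⟩ := hδ
  ⟨c, hc, by filter_upwards [h, hδ] with k h1 h2 using h1.trans h2⟩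

theorem poly_mul {ε : ℕ → ℝ≥0∞} (hε : ExpSmall ε) {T : ℕ → ℕ} (hT : PolyBounded T) :
    ExpSmall fun k => (T k : ℝ≥0∞) * ε k := by
  obtain ⟨c, hc, hε⟩ := hε
  -- Half of the exponent absorbs the polynomial.
  refine ⟨c / 2, half_pos hc, ?_⟩
  filter_upwards [hε, hT.eventually_le_rpow (half_pos hc)] with k h1 h2
  calc (T k : ℝ≥0∞) * ε k
      ≤ ENNReal.ofReal (2 ^ (c / 2 * (k : ℝ))) * ENNReal.ofReal (2 ^ (-(c * (k : ℝ)))) := by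
        refine mul_le_mul' ?_ h1
        rw [← ENNReal.ofReal_natCast]
        exact ENNReal.ofReal_le_ofReal h2
    _ = _ := by
        rw [← ENNReal.ofReal_mul (by positivity), ← Real.rpow_add two_pos]
        congr 2
        ring

theorem max {ε δ : ℕ → ℝ≥0∞} (hε : ExpSmall ε) (hδ : ExpSmall δ) :
    ExpSmall fun k => max (ε k) (δ k) := by
  obtain ⟨c, hc, hε⟩ := hε
  obtain ⟨d, hd, hδ⟩ := hδ
  refine ⟨min c d, lt_min hc hd, ?_⟩
  filter_upwards [hε, hδ] with k h1 h2
  refine max_le (h1.trans ?_) (h2.trans ?_) <;>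
  refine ENNReal.ofReal_le_ofReal (Real.rpow_le_rpow_of_exponent_le one_le_two
    (neg_le_neg (mul_le_mul_of_nonneg_right ?_ (Nat.cast_nonneg k))))
  exacts [min_le_left _ _, min_le_right _ _]

theorem add {ε δ : ℕ → ℝ≥0∞} (hε : ExpSmall ε) (hδ : ExpSmall δ) :
    ExpSmall fun k => ε k + δ k :=
  ((hε.max hδ).poly_mul (PolyBounded.const 2)).mono (.of_forall fun k => by
    push_cast
    rw [two_mul]
    exact add_le_add (le_max_left _ _) (le_max_right _ _))

theorem two_pow {D : ℕ → ℕ} (hD : (fun k : ℕ => (k : ℝ)) =O[atTop] fun k => (D k : ℝ)) :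
    ExpSmall fun k => ((2 : ℝ≥0∞) ^ D k)⁻¹ := by
  obtain ⟨C, hC0, hC⟩ := hD.exists_pos
  refine ⟨C⁻¹, inv_pos.2 hC0, hC.bound.mono fun k hk => ?_⟩
  simp only [Real.norm_natCast] at hk
  have h2 : ((2 : ℝ≥0∞) ^ D k)⁻¹ = ENNReal.ofReal (2 ^ (-(D k : ℝ))) := by
    rw [Real.rpow_neg two_pos.le, Real.rpow_natCast, ENNReal.ofReal_inv_of_pos (by positivity),
      ENNReal.ofReal_pow two_pos.le]
    simp
  refine h2.trans_le <| ENNReal.ofReal_le_ofReal 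
    (Real.rpow_le_rpow_of_exponent_le one_le_two (neg_le_neg ?_))
  rw [inv_mul_le_iff₀ hC0]
  exact hk

/-- The forking bound `a + δ / a` is balanced by `a` of the order of `√δ`, which keeps half of the
exponent. -/
theorem exists_balanced {δ : ℕ → ℝ≥0∞} (hδ : ExpSmall δ) :
    ∃ a : ℕ → ℝ≥0∞, (∀ k, a k ≠ 0 ∧ a k ≠ ∞) ∧ ExpSmall fun k => a k + (a k)⁻¹ * δ k := by
  obtain ⟨c, hc, hδ⟩ := hδ
  refine ⟨fun k => ENNReal.ofReal (2 ^ (-(c / 2 * (k : ℝ)))), fun k =>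
    ⟨(ENNReal.ofReal_pos.2 (by positivity)).ne', ENNReal.ofReal_ne_top⟩,
    add ⟨c / 2, half_pos hc, .of_forall fun k => le_rfl⟩ ⟨c / 2, half_pos hc, ?_⟩⟩
  filter_upwards [hδ] with k hk
  refine (mul_le_mul_right hk _).trans_eq ?_
  rw [← ENNReal.ofReal_inv_of_pos (by positivity), ← ENNReal.ofReal_mul (by positivity),
    ← Real.rpow_neg two_pos.le, ← Real.rpow_add two_pos]
  congr 2
  ring

end ExpSmall

end Asymptotics

/-! ## The probability of a violation -/

section Violation

variable {G : Setting} {ord : HistoryOrder G}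

/-- The expectation over the setup and the coins of the adversary. -/
noncomputable def Adversary.mean (A : Adversary G) (g : G.vc.Setup → A.Coin → ℝ≥0∞) : ℝ≥0∞ :=
  ∑' s, G.vc.law s * ∑' c, A.law c * g s c

variable (A : Adversary G)

theorem Adversary.mean_mono {g h : G.vc.Setup → A.Coin → ℝ≥0∞} (hgh : ∀ s c, g s c ≤ h s c) :
    A.mean g ≤ A.mean h :=
  ENNReal.tsum_le_tsum fun s => mul_le_mul_right
    (ENNReal.tsum_le_tsum fun c => mul_le_mul_right (hgh s c) _) _

theorem Adversary.mean_add (g h : G.vc.Setup → A.Coin → ℝ≥0∞) :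
    A.mean (fun s c => g s c + h s c) = A.mean g + A.mean h := by
  simp only [mean, mul_add, ENNReal.tsum_add]

theorem Adversary.mean_const_mul (a : ℝ≥0∞) (g : G.vc.Setup → A.Coin → ℝ≥0∞) :
    A.mean (fun s c => a * g s c) = a * A.mean g := by
  simp only [mean, mul_left_comm _ a, ENNReal.tsum_mul_left]

theorem Adversary.mean_const (a : ℝ≥0∞) : A.mean (fun _ _ => a) = a := by
  simp only [mean, ENNReal.tsum_mul_right, PMF.tsum_coe, one_mul]

theorem Adversary.mean_sum {ι : Type} (S : Finset ι) (g : ι → G.vc.Setup → A.Coin → ℝ≥0∞) :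
    A.mean (fun s c => ∑ i ∈ S, g i s c) = ∑ i ∈ S, A.mean (g i) := by
  classical
  induction S using Finset.induction_on with
  | empty => simpa using A.mean_const 0
  | insert i S hi ih => simp only [Finset.sum_insert hi, A.mean_add, ih]

/-- For fixed setup and coins the adversary is deterministic; averaging over the tables innermost
leaves a uniform choice from a finite set. -/
theorem violationProb_eq : violationProb ord A = A.mean fun s c => avg fun τ : Tables G =>
    ind (¬ TotalOrder (State.run ⟨s, τ⟩ ord (State.init G) (A.prog c))) := by
  have h : ((worldLaw G).bind fun W => A.law.map fun c => (W, c)) =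
      G.vc.law.bind fun s => A.law.bind fun c =>
        (PMF.uniformOfFintype (Tables G)).map fun τ => ((⟨s, τ⟩ : World G), c) := by
    unfold worldLaw
    rw [PMF.bind_bind]
    congr 1
    funext s
    rw [PMF.bind_map]
    simp only [← PMF.bind_pure_comp, Function.comp_def]
    rw [PMF.bind_comm]
  simp only [violationProb, h, Adversary.mean, PMF.toOuterMeasure_bind_apply,
    PMF.toOuterMeasure_map_apply]
  refine tsum_congr fun s => congrArg _ (tsum_congr fun c => congrArg _ ?_)
  rw [← uniform_toOuterMeasure]
  rfl

/-- Indices of possible premature openings. -/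
abbrev OpeningIndex (G : Setting) : Type := Fin (G.R + 1) × G.Party × G.Party × Fin G.D

theorem violationProb_le {T : ℕ} (hA : ∀ c, (A.prog c).Bounded T) {a ε : ℝ≥0∞} (ha : a ≠ 0)
    (ha' : a ≠ ∞)
    (hε : ∀ i : OpeningIndex G, (A.mean fun s c => avg fun τ => avg fun τ' => ind
      (DoubleOpens ord (A.prog c) ⟨s, τ⟩ ⟨s, mix (certSlot G i.2.1 i.1) τ τ'⟩ T i.1 i.2.1 i.2.2.1
        i.2.2.2)) ≤ ε) :
    violationProb ord A ≤ (T * T : ℕ) * ((2 : ℝ≥0∞) ^ G.lam)⁻¹ +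
      ((T * (G.R + 1) : ℕ) * ((G.starts * G.f ^ G.D : ℕ) *
        ((((2 * G.f + 1 : ℕ) : ℝ≥0∞) ^ G.D)⁻¹ * (G.D : ℝ≥0∞)⁻¹)) +
      (T * ((G.R + 1) * (G.n * (G.n * G.D))) : ℕ) *
        (a + a⁻¹ * (ε + ((2 : ℝ≥0∞) ^ G.lam)⁻¹))) := by
  have hind : ∀ s c (τ : Tables G),
      ind (¬ TotalOrder (State.run ⟨s, τ⟩ ord (State.init G) (A.prog c))) ≤
      ∑ t ∈ Finset.range T, ind (SeedReused ord (A.prog c) ⟨s, τ⟩ t) +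
      (∑ x ∈ Finset.range T ×ˢ Finset.range (G.R + 1),
          ind (SampleEscapes ord (A.prog c) ⟨s, τ⟩ x.1 x.2) +
        ∑ x ∈ Finset.range T ×ˢ (Finset.univ : Finset (OpeningIndex G)),
          ind (1 ≤ x.2.1.val ∧ PrematureOpening ord (A.prog c) ⟨s, τ⟩ T x.1 x.2.1 x.2.2.1
            x.2.2.2.1 x.2.2.2.2)) := by
    intro s c τ
    refine (ind_mono (attack_of_not_totalOrder (hA c))).trans ((ind_or_le _ _).trans
      (add_le_add ?_ ((ind_or_le _ _).trans (add_le_add ?_ ?_))))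
    · refine le_trans (ind_mono ?_) (ind_exists_le _ _)
      rintro ⟨t, ht, h⟩
      exact ⟨t, by simpa using ht, h⟩
    · refine le_trans (ind_mono ?_) (ind_exists_le _ _)
      rintro ⟨t, ht, r, hr, h⟩
      exact ⟨(t, r), by simp; omega, h⟩
    · refine le_trans (ind_mono ?_) (ind_exists_le _ _)
      rintro ⟨t, ht, r, hr, hrR, k, k', j, h⟩
      exact ⟨(t, ⟨r, by omega⟩, k, k', j), by simpa using ht, hr, h⟩
  rw [violationProb_eq]
  refine (A.mean_mono fun s c => avg_mono fun τ => hind s c τ).trans ?_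
  simp only [avg_add, avg_sum, A.mean_add, A.mean_sum]
  refine add_le_add ?_ (add_le_add ?_ ?_)
  · refine (Finset.sum_le_card_nsmul _ _ (T * ((2 : ℝ≥0∞) ^ G.lam)⁻¹) fun t ht => ?_).trans_eq ?_
    · refine (A.mean_mono fun s c => (avg_seedReused_le s t).trans
        (mul_le_mul_left (Nat.cast_le.2 (Finset.mem_range.1 ht).le) _)).trans_eq (A.mean_const _)
    · simp [mul_assoc]
  · refine (Finset.sum_le_card_nsmul _ _ ((G.starts * G.f ^ G.D : ℕ) *
      ((((2 * G.f + 1 : ℕ) : ℝ≥0∞) ^ G.D)⁻¹ * (G.D : ℝ≥0∞)⁻¹)) fun x _ => ?_).trans_eq ?_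
    · exact (A.mean_mono fun s c => avg_sampleEscapes_le s x.1 x.2).trans_eq (A.mean_const _)
    · simp
  · refine (Finset.sum_le_card_nsmul _ _ (a + a⁻¹ * (ε + ((2 : ℝ≥0∞) ^ G.lam)⁻¹))
      fun x _ => ?_).trans_eq ?_
    · obtain ⟨t, i⟩ := x
      by_cases hr : 1 ≤ i.1.val
      · refine (A.mean_mono fun s c => (avg_mono fun τ => ind_mono And.right).trans
          (avg_prematureOpening_le s T t i.1 hr i.2.1 i.2.2.1 i.2.2.2 ha ha')).trans ?_
        rw [A.mean_add, A.mean_const, A.mean_const_mul, A.mean_add, A.mean_const]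
        gcongr
        exact hε i
      -- Genesis certificates are never missing, so round `0` contributes nothing.
      · have : ∀ p, ind (1 ≤ i.1.val ∧ p) = 0 := fun p => by simp [ind, hr]
        simp only [this, avg_const, A.mean_const]
        exact zero_le
    · rw [nsmul_eq_mul, Finset.card_product, Finset.card_range, Finset.card_univ]
      simp only [Fintype.card_prod, Fintype.card_fin]

/-- Position binding concerns one attacker per security parameter. Among the finitely many indices
the one with the largest advantage serves for all. -/
theorem exists_uniform_attacker {b T : ℕ} (hb : OpsBounded G.vc b)
    (hA : ∀ c, (A.prog c).Bounded T) (ord : HistoryOrder G) :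
    ∃ B : VectorCommitment.Attacker G.vc,
      (∀ c, (B.prog c).Bounded (2 * (T * (1 + (G.n + G.D + 1) * b)))) ∧
      ∀ i : OpeningIndex G, (A.mean fun s c => avg fun τ => avg fun τ' => ind
        (DoubleOpens ord (A.prog c) ⟨s, τ⟩ ⟨s, mix (certSlot G i.2.1 i.1) τ τ'⟩ T i.1 i.2.1
          i.2.2.1 i.2.2.2)) ≤ B.advantage := by
  have h := fun i : OpeningIndex G =>
    exists_attacker (ord := ord) hb A hA i.1 i.2.1 i.2.2.1 i.2.2.2
  choose B hB hadv using h
  obtain ⟨i₀, -, hi₀⟩ := Finset.exists_max_image (Finset.univ : Finset (OpeningIndex G))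
    (fun i => (B i).advantage) ⟨(0, 0, 0, ⟨0, G.D_pos⟩), Finset.mem_univ _⟩
  exact ⟨B i₀, hB i₀, fun i => (hadv i).trans (hi₀ i (Finset.mem_univ i))⟩

/-- The final acceptance probability `1 / D` cancels the factor `D` in the number of starting
points, and `f / (2f + 1) ≤ 1 / 2`. -/
theorem alba_bound_le (lam f : ℕ) {D : ℕ} (hD : 0 < D) :
    ((2 * D * lam * f ^ D : ℕ) : ℝ≥0∞) * ((((2 * f + 1 : ℕ) : ℝ≥0∞) ^ D)⁻¹ * (D : ℝ≥0∞)⁻¹) ≤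
      (2 * lam : ℕ) * ((2 : ℝ≥0∞) ^ D)⁻¹ := by
  rw [← ENNReal.mul_inv (by simp) (.inr (by simp [hD.ne'])), ← div_eq_mul_inv, ← div_eq_mul_inv,
    ENNReal.div_le_iff_le_mul (.inl (by simp [hD.ne'])) (.inl (by finiteness)),
    ENNReal.mul_comm_div, mul_div_assoc']
  rw [ENNReal.le_div_iff_mul_le (.inl (by simp)) (.inl (by simp))]
  norm_cast
  calc 2 * D * lam * f ^ D * 2 ^ D = 2 * lam * ((2 * f) ^ D * D) := by rw [mul_pow]; ring
    _ ≤ 2 * lam * ((2 * f + 1) ^ D * D) := by gcongr; omega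

end Violation

end SparseBullshark

theorem mainTheorem1
    (G : ℕ → SparseBullshark.Setting)
    (hlam : ∀ k, (G k).lam = k)
    (hf : SparseBullshark.PolyBounded fun k => (G k).f)
    (hR : SparseBullshark.PolyBounded fun k => (G k).R)
    (hD : (fun k => ((G k).D : ℝ)) =Θ[Filter.atTop] fun k : ℕ => (k : ℝ))
    (hvc_efficient : SparseBullshark.VectorCommitment.Efficient fun k => (G k).vc)
    (hvc_binding : SparseBullshark.VectorCommitment.PositionBinding fun k => (G k).vc)
    (ord : ∀ k, SparseBullshark.HistoryOrder (G k))
    (T : ℕ → ℕ) (hT : SparseBullshark.PolyBounded T)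
    (A : ∀ k, SparseBullshark.Adversary (G k))
    (hA : ∀ k c, ((A k).prog c).Bounded (T k)) :
    SparseBullshark.ExpSmall fun k => SparseBullshark.violationProb (ord k) (A k) := by
  open SparseBullshark in
  obtain ⟨b, hb, hops⟩ := hvc_efficient
  have hDpoly : PolyBounded fun k => (G k).D := .of_isBigO hD.1
  have hn : PolyBounded fun k => (G k).n := ((PolyBounded.const 3).mul hf).add (.const 1)
  have hR1 : PolyBounded fun k => (G k).R + 1 := hR.add (.const 1)
  choose B hB hadv using fun k => exists_uniform_attacker (A k) (hops k) (hA k) (ord k)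
  have hbind := hvc_binding _ B ((PolyBounded.const 2).mul
    (hT.mul ((PolyBounded.const 1).add (((hn.add hDpoly).add (.const 1)).mul hb)))) hB
  have hpow : ExpSmall fun k => ((2 : ENNReal) ^ (G k).lam)⁻¹ := by
    simp only [hlam]
    exact ExpSmall.two_pow (Asymptotics.isBigO_refl _ _)
  -- The forking threshold `a` is adapted to the attacker's advantage plus the collision probability
  -- of certificates.
  obtain ⟨a, ha, hsmall⟩ := (hbind.add hpow).exists_balanced
  refine ExpSmall.mono ?_ (.of_forall fun k =>
    violationProb_le (A k) (hA k) (ha k).1 (ha k).2 (hadv k))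
  refine (hpow.poly_mul (hT.mul hT)).add (ExpSmall.add ?_
    (hsmall.poly_mul (hT.mul (hR1.mul (hn.mul (hn.mul hDpoly))))))
  refine ExpSmall.poly_mul (ExpSmall.mono ?_ (.of_forall fun k =>
    alba_bound_le (G k).lam (G k).f (G k).D_pos)) (hT.mul hR1)
  simp only [hlam]
  -- The lower bound on the growth of `D` makes `2 ^ (-D)` exponentially small in `lam`.
  exact (ExpSmall.two_pow hD.2).poly_mul ((PolyBounded.const 2).mul .id)
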